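/- Let $\beta=(\beta_w)_{|w|\le 4}$ be a real sequence indexed by the words of length at most $4$ in two noncommuting letters $X,Y$, with $\beta_v=\beta_w$ whenever $v$ is a cyclic permutation of $w$ and $\beta_{w^*}=\beta_w$, where $w^*$ is the reversed word. Let $\mathcal M_2=(\beta_{U^*V})_{|U|,|V|\le 2}$ be its $7\times 7$ moment matrix, with columns $\mathbf 1,\mathbb X,\mathbb Y,\mathbb X^2,\mathbb X\mathbb Y,\mathbb Y\mathbb X,\mathbb Y^2$. A representing measure of $\beta$ consists of finitely many atoms $(A_i,B_i)$, pairs of real symmetric $t_i\times t_i$ matrices ($t_i\ge 1$), with densities $\lambda_i>0$, $\sum_i\lambda_i=1$, such that $\beta_w=\sum_i\lambda_i\,\tfrac1{t_i}\operatorname{tr}(w(A_i,B_i))$ for all $|w|\le 4$. It is of type $(m_1,\dots,m_r)$ if it has exactly $m_k$ atoms of size $k$ for $k\le r$, none of larger size, and $m_r\ne 0$. It is minimal if no representing measure of $\beta$ has a type $(m_1',\dots,m_{r'}')$ with $r'<r$, or with $r'=r$ and $m'_k<m_k$ for the largest $k$ with $m'_k\neq m_k$. The sequence $\beta$ admits an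 nc measure if it has a minimal representing measure of a type with $r>1$. Two measures are orthogonally equivalent if, after a renumbering of the atoms, they have the same densities and each atom $(A_i,B_i)$ of the first corresponds to an atom $(UA_iU^t,UB_iU^t)$ of the second with $U=U_i$ an orthogonal matrix. Suppose that $\beta_1=1$, $\beta_{X^2Y^2}\ne\beta_{XYXY}$, $\operatorname{rank}\mathcal M_2=5$, and that the columns of $\mathcal M_2$ satisfy $\mathbb X\mathbb Y+\mathbb Y\mathbb X=\mathbf 0$ and $\mathbb Y^2=\mathbf 1$. Then $\beta$ admits an nc measure if and only if one of the following holds: 1. $\mathcal M_2$ is positive semidefinite and $\beta_{X^3}=\beta_Y=0$; 2. $\mathcal M_2$ is positive semidefinite and $$\beta_{X^3}=0,\quad \beta_{X^2}>0,\quad 0<|\beta_Y|<1,\quad \beta_{X^4}\ge\frac{\beta_{X^2}^2}{1-|\beta_Y|}.\qquad(\ast)$$ In case 1 the minimal representing measure exists, is unique up to orthogonal equivalence, and is of type $(2,1)$. If $(\ast)$ holds, the minimal representing measure exists and is unique up to orthogonal equivalence; it is of type $(1,1)$ if and only if $\beta_{X^4}=\beta_{X^2}^2/(1-|\beta_Y|)$,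 and otherwise of type $(2,1)$. -/

import Mathlib

namespace TracialMoment

/-- The two noncommuting letters. Words in `X, Y` are lists of letters. -/
inductive Letter : Type
  | X
  | Y

/-- A sequence of real numbers indexed by the words in `X, Y` of length at most `4`, invariant under
cyclic permutation and under reversal of words. -/
structure TracialSequence where
  toFun : {w : List Letter // w.length ≤ 4} → ℝ
  cyclic : ∀ v w : {w : List Letter // w.length ≤ 4}, v.1.IsRotated w.1 → toFun v = toFun w
  reversal : ∀ v w : {w : List Letter // w.length ≤ 4}, w.1 = v.1.reverse → toFun v = toFun w

/-- The entry `β_w`. -/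
def TracialSequence.moment (β : TracialSequence) (w : List Letter)
    (hw : w.length ≤ 4 := by simp) : ℝ :=
  β.toFun ⟨w, hw⟩

/-- `β_1 = 1`. -/
def TracialSequence.IsNormalized (β : TracialSequence) : Prop :=
  β.moment [] = 1

/-- `β_{X²Y²} ≠ β_{XYXY}`. -/
def TracialSequence.IsNoncommutative (β : TracialSequence) : Prop :=
  β.moment [.X, .X, .Y, .Y] ≠ β.moment [.X, .Y, .X, .Y]

/-- The words of length at most `2` in degree-lexicographic order:
`1, X, Y, X², XY, YX, Y²`. -/
def wordsTwo : Fin 7 → List Letter :=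
  ![[], [.X], [.Y], [.X, .X], [.X, .Y], [.Y, .X], [.Y, .Y]]

theorem length_wordsTwo_le (i : Fin 7) : (wordsTwo i).length ≤ 2 := by
  fin_cases i <;> simp [wordsTwo]

theorem length_reverse_append_le (i : Fin 7) {w : List Letter} (hw : w.length ≤ 2) :
    ((wordsTwo i).reverse ++ w).length ≤ 4 := by
  have h := length_wordsTwo_le i
  simp only [List.length_append, List.length_reverse]
  omega

/-- The column of the moment matrix indexed by the word `w`; its entry in the row `U` is
`β_{U* w}`. -/
def TracialSequence.column (β : TracialSequence) (w : List Letter)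
    (hw : w.length ≤ 2 := by simp) : Fin 7 → ℝ :=
  fun i => β.moment ((wordsTwo i).reverse ++ w) (length_reverse_append_le i hw)

/-- The truncated moment matrix of order `2`, with entry `β_{U* V}` in row `U` and column `V`. -/
def TracialSequence.momentMatrix (β : TracialSequence) : Matrix (Fin 7) (Fin 7) ℝ :=
  Matrix.of fun i j => β.column (wordsTwo j) (length_wordsTwo_le j) i

/-- The value `w(A, B)` of a word at a pair of square matrices. -/
def evalWord {t : ℕ} (A B : Matrix (Fin t) (Fin t) ℝ) (w : List Letter) :
    Matrix (Fin t) (Fin t) ℝ :=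
  (w.map fun l => match l with
    | .X => A
    | .Y => B).prod

/-- Finitely many pairs of real symmetric matrices (the atoms) with positive densities of
sum `1`. -/
structure AtomicMeasure where
  N : ℕ
  size : Fin N → ℕ
  size_pos : ∀ i, 0 < size i
  density : Fin N → ℝ
  density_pos : ∀ i, 0 < density i
  density_sum : ∑ i, density i = 1
  A : (i : Fin N) → Matrix (Fin (size i)) (Fin (size i)) ℝ
  B : (i : Fin N) → Matrix (Fin (size i)) (Fin (size i)) ℝ
  A_symm : ∀ i, (A i).IsSymm
  B_symm : ∀ i, (B i).IsSymm

/-- `β_w = ∑ i, λ_i Tr (w(A_i, B_i))` for all words `w` of length at most `4`, with the normalized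
trace `Tr`. -/
def AtomicMeasure.Represents (μ : AtomicMeasure) (β : TracialSequence) : Prop :=
  ∀ (w : List Letter) (hw : w.length ≤ 4),
    β.moment w hw =
      ∑ i, μ.density i * ((1 / (μ.size i : ℝ)) * (evalWord (μ.A i) (μ.B i) w).trace)

/-- The number of atoms of size `k`. -/
def AtomicMeasure.count (μ : AtomicMeasure) (k : ℕ) : ℕ :=
  (Finset.univ.filter fun i => μ.size i = k).card

/-- The largest size of an atom. -/
def AtomicMeasure.maxSize (μ : AtomicMeasure) : ℕ :=
  Finset.univ.sup μ.size

/-- The measure is of type `(m_1, …, m_r)`: there are exactly `m_k` atoms of size `k`, and `r` is the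
largest size of an atom. -/
def AtomicMeasure.HasType (μ : AtomicMeasure) (m : List ℕ) : Prop :=
  m.length = μ.maxSize ∧ ∀ (k : ℕ) (hk : k < m.length), μ.count (k + 1) = m[k]

/-- The type of `μ` is strictly smaller than that of `ν`: either the largest size is smaller, or the
largest sizes agree and, going down from the largest size, the first size at which the numbers of
atoms differ has fewer atoms in `μ`. -/
def AtomicMeasure.SmallerType (μ ν : AtomicMeasure) : Prop :=
  μ.maxSize < ν.maxSize ∨
    (μ.maxSize = ν.maxSize ∧ ∃ k : ℕ, 1 ≤ k ∧ k ≤ μ.maxSize ∧ μ.count k < ν.count k ∧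
      ∀ j : ℕ, k < j → j ≤ μ.maxSize → μ.count j = ν.count j)

/-- `μ` is a minimal representing measure of `β`. -/
def AtomicMeasure.IsMinimal (μ : AtomicMeasure) (β : TracialSequence) : Prop :=
  μ.Represents β ∧ ∀ ν : AtomicMeasure, ν.Represents β → ¬ ν.SmallerType μ

/-- `β` admits a minimal measure of type `(m_1, …, m_r)` with `r > 1`. -/
def TracialSequence.AdmitsNCMeasure (β : TracialSequence) : Prop :=
  ∃ μ : AtomicMeasure, μ.IsMinimal β ∧ 1 < μ.maxSize

/-- The two measures agree up to the enumeration of the atoms and the replacement of each atom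
`(A, B)` by `(U A Uᵀ, U B Uᵀ)` with an orthogonal matrix `U`. -/
def AtomicMeasure.OrthogonallyEquivalent (μ ν : AtomicMeasure) : Prop :=
  ∃ σ : Fin μ.N ≃ Fin ν.N, ∀ i : Fin μ.N,
    μ.size i = ν.size (σ i) ∧ μ.density i = ν.density (σ i) ∧
      ∃ U : Matrix (Fin (ν.size (σ i))) (Fin (μ.size i)) ℝ,
        U * U.transpose = 1 ∧ U.transpose * U = 1 ∧
          ν.A (σ i) = U * μ.A i * U.transpose ∧ ν.B (σ i) = U * μ.B i * U.transpose

/-- A minimal representing measure of `β` exists and is unique up to orthogonal equivalence. -/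
def TracialSequence.HasUniqueMinimalMeasure (β : TracialSequence) : Prop :=
  ∃ μ : AtomicMeasure, μ.IsMinimal β ∧
    ∀ ν : AtomicMeasure, ν.IsMinimal β → μ.OrthogonallyEquivalent ν

/-- `β_{X³} = 0`, `β_{X²} > 0`, `0 < |β_Y| < 1` and `β_{X⁴} ≥ β_{X²}² / (1 - |β_Y|)`. -/
def TracialSequence.MomentConditions (β : TracialSequence) : Prop :=
  β.moment [.X, .X, .X] = 0 ∧ 0 < β.moment [.X, .X] ∧
    0 < |β.moment [.Y]| ∧ |β.moment [.Y]| < 1 ∧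
      β.moment [.X, .X] ^ 2 / (1 - |β.moment [.Y]|) ≤ β.moment [.X, .X, .X, .X]

end TracialMoment

/-!
The column relations force every atom of a representing measure to be an anticommuting pair `(A, B)`
with `B² = 1`. An atom of size one is then `(0, ±1)`, and an atom of size two with `A ≠ 0` is
orthogonally similar to `(!![0, x; x, 0], !![1, 0; 0, -1])` with `x > 0`. Write `c`, `e` and `b` for
the moments of `X²`, `X⁴` and `Y`. Since `1 + sB` is twice a projection that commutes with `A²`, the
trace of `(1 + pA²)² (1 + sB)` is nonnegative for `s = ±1`, whence `c² ≤ e (1 - |b|)`. Conversely,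
one atom of size two and density `c² / e` and atoms `(0, ±1)` of densities `(1 - c² / e ± b) / 2`
represent the sequence; among the measures with a single atom of size two and no larger ones, these
data are forced as soon as the number of atoms is the least possible.
-/

namespace TracialMoment

open Matrix

/-! ### Moment sequences with the column relations `XY + YX = 0` and `Y² = 1` -/

/-- The normalized sequences whose moment matrix satisfies the column relations `XY + YX = 0` and
`Y² = 1`; all of the argument takes place among these. -/
structure TracialSequence.IsAnticommuting (β : TracialSequence) : Prop where
  isNormalized : β.IsNormalized
  column_XY_add_column_YX : β.column [.X, .Y] + β.column [.Y, .X] = 0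
  column_YY : β.column [.Y, .Y] = β.column []

theorem exists_wordsTwo_eq {w : List Letter} (hw : w.length ≤ 2) : ∃ i, wordsTwo i = w :=
  match w with
  | [] => ⟨0, rfl⟩
  | [.X] => ⟨1, rfl⟩
  | [.Y] => ⟨2, rfl⟩
  | [.X, .X] => ⟨3, rfl⟩
  | [.X, .Y] => ⟨4, rfl⟩
  | [.Y, .X] => ⟨5, rfl⟩
  | [.Y, .Y] => ⟨6, rfl⟩
  | _ :: _ :: _ :: _ => by simp at hw

namespace TracialSequence

theorem moment_cons (β : TracialSequence) (l : Letter) (w : List Letter)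
    (hw : (l :: w).length ≤ 4) :
    β.moment (l :: w) hw = β.moment (w ++ [l]) (by simpa using hw) :=
  β.cyclic ⟨l :: w, hw⟩ ⟨w ++ [l], _⟩ ⟨1, by simp⟩

theorem momentMatrix_isHermitian (β : TracialSequence) : β.momentMatrix.IsHermitian := by
  ext i j
  exact β.reversal _ _ (by simp)

theorem moment_XX_nonneg {β : TracialSequence} (h : β.momentMatrix.PosSemidef) :
    0 ≤ β.moment [.X, .X] :=
  h.diag_nonneg (i := 1)

namespace IsAnticommuting

variable {β : TracialSequence}

theorem moment_append_XY (hβ : β.IsAnticommuting) (u : List Letter) (hu : u.length ≤ 2) :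
    β.moment (u ++ [.X, .Y]) (by simp; omega) = -β.moment (u ++ [.Y, .X]) (by simp; omega) := by
  obtain ⟨i, hi⟩ := exists_wordsTwo_eq (w := u.reverse) (by simpa using hu)
  have h := congrFun hβ.column_XY_add_column_YX i
  simp only [Pi.add_apply, Pi.zero_apply, column, hi, List.reverse_reverse] at h
  exact eq_neg_of_add_eq_zero_left h

theorem moment_append_YY (hβ : β.IsAnticommuting) (u : List Letter) (hu : u.length ≤ 2) :
    β.moment (u ++ [.Y, .Y]) (by simp; omega) = β.moment u (by omega) := by
  obtain ⟨i, hi⟩ := exists_wordsTwo_eq (w := u.reverse) (by simpa using hu)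
  have h := congrFun hβ.column_YY i
  simpa only [column, hi, List.reverse_reverse, List.append_nil] using h

end IsAnticommuting

end TracialSequence

/-- The moment of the word `w` that traciality and the relations `XY + YX = 0` and `Y² = 1` force,
in terms of `b = β_Y`, `c = β_{X²}`, `d = β_{X³}` and `e = β_{X⁴}`. -/
def reducedMoment (b c d e : ℝ) : List Letter → ℝ
  | [] => 1
  | [.Y] => b
  | [.X, .X] => c
  | [.Y, .Y] => 1
  | [.X, .X, .X] => d
  | [.Y, .Y, .Y] => b
  | [.X, .X, .X, .X] => e
  | [.X, .X, .Y, .Y] => c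
  | [.X, .Y, .Y, .X] => c
  | [.Y, .Y, .X, .X] => c
  | [.Y, .X, .X, .Y] => c
  | [.X, .Y, .X, .Y] => -c
  | [.Y, .X, .Y, .X] => -c
  | [.Y, .Y, .Y, .Y] => 1
  | _ => 0

namespace TracialSequence.IsAnticommuting

variable {β : TracialSequence}

theorem moment_X (hβ : β.IsAnticommuting) : β.moment [.X] = 0 := by
  refine self_eq_neg.1 ?_
  calc β.moment [.X]
      = β.moment [.X, .Y, .Y] := (hβ.moment_append_YY [.X] (by simp)).symm
    _ = β.moment [.Y, .Y, .X] := β.moment_cons .X [.Y, .Y] (by simp)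
    _ = -β.moment [.Y, .X, .Y] :=
        neg_eq_iff_eq_neg.1 (hβ.moment_append_XY [.Y] (by simp)).symm
    _ = -β.moment [.X, .Y, .Y] := by rw [β.moment_cons .Y [.X, .Y]]; rfl
    _ = -β.moment [.X] := congrArg Neg.neg (hβ.moment_append_YY [.X] (by simp))

theorem moment_XY (hβ : β.IsAnticommuting) : β.moment [.X, .Y] = 0 :=
  self_eq_neg.1 <| (hβ.moment_append_XY [] (by simp)).trans <|
    congrArg Neg.neg (β.moment_cons .X [.Y] (by simp)).symm

theorem moment_XXY (hβ : β.IsAnticommuting) : β.moment [.X, .X, .Y] = 0 :=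
  self_eq_neg.1 <| (hβ.moment_append_XY [.X] (by simp)).trans <|
    congrArg Neg.neg (β.moment_cons .X [.X, .Y] (by simp)).symm

theorem moment_XXXY (hβ : β.IsAnticommuting) : β.moment [.X, .X, .X, .Y] = 0 :=
  self_eq_neg.1 <| (hβ.moment_append_XY [.X, .X] (by simp)).trans <|
    congrArg Neg.neg (β.moment_cons .X [.X, .X, .Y] (by simp)).symm

theorem moment_XYXY (hβ : β.IsAnticommuting) :
    β.moment [.X, .Y, .X, .Y] = -β.moment [.X, .X] := by
  calc β.moment [.X, .Y, .X, .Y]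
      = -β.moment [.X, .Y, .Y, .X] := hβ.moment_append_XY [.X, .Y] (by simp)
    _ = -β.moment [.X, .X, .Y, .Y] :=
        congrArg Neg.neg (β.moment_cons .X [.X, .Y, .Y] (by simp)).symm
    _ = -β.moment [.X, .X] := congrArg Neg.neg (hβ.moment_append_YY [.X, .X] (by simp))

theorem moment_eq (hβ : β.IsAnticommuting) (w : List Letter) (hw : w.length ≤ 4) :
    β.moment w hw = reducedMoment (β.moment [.Y]) (β.moment [.X, .X]) (β.moment [.X, .X, .X])
      (β.moment [.X, .X, .X, .X]) w := by
  have cancel := hβ.moment_append_YY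
  have moment_nil : β.moment [] = 1 := hβ.isNormalized
  have moment_X := hβ.moment_X
  have moment_XY := hβ.moment_XY
  have moment_XXY := hβ.moment_XXY
  have moment_XXXY := hβ.moment_XXXY
  have moment_XYXY := hβ.moment_XYXY
  have moment_YY := (cancel [] (by simp)).trans moment_nil
  have moment_YYYY := (cancel [.Y, .Y] (by simp)).trans moment_YY
  have moment_YYY := cancel [.Y] (by simp)
  have moment_XYY := (cancel [.X] (by simp)).trans moment_X
  have moment_XYYY := (cancel [.X, .Y] (by simp)).trans moment_XY
  have moment_XXYY := cancel [.X, .X] (by simp)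
  -- Every other word is a rotation of one of these.
  rcases w with _ | ⟨_ | _, _ | ⟨_ | _, _ | ⟨_ | _, _ | ⟨_ | _, _ | ⟨_, w⟩⟩⟩⟩⟩ <;>
  first
  | rfl
  | (simp only [List.length_cons] at hw; omega)
  | assumption
  | (refine (β.moment_cons _ _ _).trans ?_; assumption)
  | (iterate 2 refine (β.moment_cons _ _ _).trans ?_
     assumption)
  | (iterate 3 refine (β.moment_cons _ _ _).trans ?_
     assumption)

end TracialSequence.IsAnticommuting

/-! ### Anticommuting pairs of symmetric matrices -/

/-- The pairs `(A, B)` of real symmetric matrices with `AB + BA = 0` and `B² = 1`: the possible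
atoms of a measure representing an anticommuting sequence. -/
structure IsAnticommutingPair {n : Type*} [Fintype n] [DecidableEq n] (A B : Matrix n n ℝ) :
    Prop where
  symm_left : A.IsSymm
  symm_right : B.IsSymm
  anticomm : A * B + B * A = 0
  sq_right : B * B = 1

theorem trace_transpose_mul_self_nonneg {m n : Type*} [Fintype m] [Fintype n] (P : Matrix m n ℝ) :
    0 ≤ (Pᵀ * P).trace := by
  simpa only [conjTranspose_eq_transpose_of_trivial] using
    (posSemidef_conjTranspose_mul_self P).trace_nonneg

theorem trace_eq_zero_of_semiconjBy_neg {n : Type*} [Fintype n] [DecidableEq n]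
    {B P : Matrix n n ℝ} (hB : B * B = 1) (h : SemiconjBy B P (-P)) : P.trace = 0 := by
  refine self_eq_neg.1 ?_
  calc P.trace
      = (B * (B * P)).trace := by rw [← mul_assoc, hB, one_mul]
    _ = (B * (-P * B)).trace := by rw [h.eq]
    _ = (-P * (B * B)).trace := by rw [trace_mul_comm, mul_assoc]
    _ = -P.trace := by rw [hB, mul_one, trace_neg]

/-- For a symmetric involution `B` and a sign `s`, the matrix `1 + sB` is twice a projection. -/
theorem trace_mul_self_add_nonneg {n : Type*} [Fintype n] [DecidableEq n] {B G : Matrix n n ℝ}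
    (hBsymm : B.IsSymm) (hB : B * B = 1) (hGsymm : G.IsSymm) (hG : Commute B G) {s : ℝ}
    (hs : s * s = 1) : 0 ≤ (G * G).trace + s * (G * G * B).trace := by
  have sq_one_add : (1 + s • B) * (1 + s • B) = (2 : ℝ) • (1 + s • B) := by
    rw [mul_add, mul_one, add_mul, one_mul, smul_mul_smul_comm, hs, hB, one_smul, two_smul]
    abel
  have hcomm : Commute (1 + s • B) G := (Commute.one_left G).add_left (hG.smul_left s)
  have key : ((1 + s • B) * G)ᵀ * ((1 + s • B) * G) = (2 : ℝ) • (G * G + s • (G * G * B)) := by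
    calc ((1 + s • B) * G)ᵀ * ((1 + s • B) * G)
        = (G * (1 + s • B)) * ((1 + s • B) * G) := by
          rw [transpose_mul, hGsymm.eq, transpose_add, transpose_one, transpose_smul, hBsymm.eq]
      _ = G * (((1 + s • B) * (1 + s • B)) * G) := by simp only [mul_assoc]
      _ = (2 : ℝ) • (G * (G * (1 + s • B))) := by
          rw [sq_one_add, smul_mul_assoc, mul_smul_comm, hcomm.eq]
      _ = (2 : ℝ) • (G * G + s • (G * G * B)) := by
          rw [mul_add, mul_add, mul_one, mul_smul_comm, mul_smul_comm, mul_assoc]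
  have h := trace_transpose_mul_self_nonneg ((1 + s • B) * G)
  rw [key, trace_smul, trace_add, trace_smul, smul_eq_mul, smul_eq_mul] at h
  linarith

namespace IsAnticommutingPair

variable {n : Type*} [Fintype n] [DecidableEq n] {A B : Matrix n n ℝ}

theorem semiconjBy (h : IsAnticommutingPair A B) : SemiconjBy B A (-A) := by
  rw [SemiconjBy, neg_mul]
  exact eq_neg_of_add_eq_zero_right h.anticomm

theorem commute_sq (h : IsAnticommutingPair A B) : Commute B (A ^ 2) := by
  simpa only [Commute, neg_sq] using h.semiconjBy.pow_right 2

theorem trace_pow_three (h : IsAnticommutingPair A B) : (A ^ 3).trace = 0 :=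
  trace_eq_zero_of_semiconjBy_neg h.sq_right <| by
    simpa only [Odd.neg_pow (by decide : Odd 3)] using h.semiconjBy.pow_right 3

theorem trace_pow_succ_mul (h : IsAnticommutingPair A B) (k : ℕ) :
    (A ^ (k + 1) * B).trace = 0 := by
  refine self_eq_neg.1 ?_
  calc (A ^ (k + 1) * B).trace
      = (A ^ k * (A * B)).trace := by rw [pow_succ, mul_assoc]
    _ = -(A ^ k * B * A).trace := by
        rw [eq_neg_of_add_eq_zero_left h.anticomm, mul_neg, trace_neg, mul_assoc]
    _ = -(A ^ (k + 1) * B).trace := by rw [trace_mul_comm, ← mul_assoc, pow_succ']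

theorem trace_quadratic_nonneg (h : IsAnticommutingPair A B) {s : ℝ} (hs : s * s = 1) (p : ℝ) :
    0 ≤ p ^ 2 * (A ^ 4).trace + 2 * p * (A ^ 2).trace +
      ((1 : Matrix n n ℝ).trace + s * B.trace) := by
  have h_symm : (p • A ^ 2 + (1 : Matrix n n ℝ)).IsSymm :=
    ((h.symm_left.pow 2).smul p).add isSymm_one
  have h_comm : Commute B (p • A ^ 2 + (1 : Matrix n n ℝ)) :=
    (h.commute_sq.smul_right p).add_right (Commute.one_right B)
  have sq_eq : (p • A ^ 2 + (1 : Matrix n n ℝ)) * (p • A ^ 2 + 1) =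
      p ^ 2 • A ^ 4 + (2 * p) • A ^ 2 + 1 := by
    simp only [mul_add, add_mul, smul_mul_smul_comm, mul_one, one_mul, ← pow_add]
    module
  have key := trace_mul_self_add_nonneg h.symm_right h.sq_right h_symm h_comm hs
  rw [sq_eq] at key
  simp only [add_mul, smul_mul_assoc, one_mul, trace_add, trace_smul, smul_eq_mul,
    h.trace_pow_succ_mul 1, h.trace_pow_succ_mul 3] at key
  linarith

end IsAnticommutingPair

/-! ### Normal forms of anticommuting pairs of size one and two -/

/-- Simultaneous similarity of two pairs of real square matrices by an orthogonal matrix. The index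
types are allowed to differ, since two atoms of equal size are indexed by different types. -/
def OrthogonallySimilar {m n : Type*} [Fintype m] [Fintype n] [DecidableEq m] [DecidableEq n]
    (A B : Matrix m m ℝ) (A' B' : Matrix n n ℝ) : Prop :=
  ∃ U : Matrix n m ℝ, U * Uᵀ = 1 ∧ Uᵀ * U = 1 ∧ A' = U * A * Uᵀ ∧ B' = U * B * Uᵀ

/-- The off-diagonal symmetric matrix with entry `x`; an anticommuting pair `(A, B)` of size two
with `A ≠ 0` has the normal form `(flip x, signs)`. -/
def flip (x : ℝ) : Matrix (Fin 2) (Fin 2) ℝ :=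
  !![0, x; x, 0]

/-- The diagonal matrix with entries `1` and `-1`, the second member of the normal form of size
two. -/
def signs : Matrix (Fin 2) (Fin 2) ℝ :=
  !![1, 0; 0, -1]

/-- The matrix of size one with entry `r`; an anticommuting pair of size one has the normal form
`(0, point s)` with a sign `s`. -/
def point (r : ℝ) : Matrix (Fin 1) (Fin 1) ℝ :=
  r • 1

theorem isAnticommutingPair_flip_signs (x : ℝ) : IsAnticommutingPair (flip x) signs where
  symm_left := by ext i j; fin_cases i <;> fin_cases j <;> rfl
  symm_right := by ext i j; fin_cases i <;> fin_cases j <;> rfl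
  anticomm := by ext i j; fin_cases i <;> fin_cases j <;> simp [flip, signs]
  sq_right := by simp [signs, one_fin_two]

theorem isAnticommutingPair_zero_point {s : ℝ} (hs : s * s = 1) :
    IsAnticommutingPair 0 (point s) where
  symm_left := isSymm_zero
  symm_right := isSymm_one.smul s
  anticomm := by rw [Matrix.zero_mul, Matrix.mul_zero, add_zero]
  sq_right := by rw [point, smul_mul_smul_comm, hs, Matrix.one_mul, one_smul]

theorem flip_sq (x : ℝ) : flip x ^ 2 = x ^ 2 • (1 : Matrix (Fin 2) (Fin 2) ℝ) := by
  simp [flip, sq, one_fin_two, smul_of]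

theorem trace_flip_pow_two (x : ℝ) : (flip x ^ 2).trace = 2 * x ^ 2 := by
  rw [flip_sq, trace_smul, trace_one, Fintype.card_fin, Nat.cast_ofNat, smul_eq_mul, mul_comm]

theorem trace_flip_pow_four (x : ℝ) : (flip x ^ 4).trace = 2 * x ^ 4 := by
  rw [pow_mul _ 2 2, flip_sq, smul_pow, one_pow, ← pow_mul, trace_smul, trace_one,
    Fintype.card_fin, Nat.cast_ofNat, smul_eq_mul, mul_comm]

theorem trace_signs : signs.trace = 0 := by simp [signs, trace_fin_two]

theorem trace_point (s : ℝ) : (point s).trace = s := by simp [point]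

namespace OrthogonallySimilar

variable {l m n : Type*} [Fintype l] [Fintype m] [Fintype n] [DecidableEq l] [DecidableEq m]
  [DecidableEq n] {A B : Matrix l l ℝ} {A' B' : Matrix m m ℝ} {A'' B'' : Matrix n n ℝ}

theorem symm (h : OrthogonallySimilar A B A' B') : OrthogonallySimilar A' B' A B := by
  obtain ⟨U, hU, hU', rfl, rfl⟩ := h
  have cancel (P : Matrix l l ℝ) : P = Uᵀ * (U * P * Uᵀ) * Uᵀᵀ := by
    calc P = (Uᵀ * U) * P * (Uᵀ * U) := by rw [hU', one_mul, mul_one]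
      _ = Uᵀ * (U * P * Uᵀ) * Uᵀᵀ := by simp only [transpose_transpose, Matrix.mul_assoc]
  exact ⟨Uᵀ, by rwa [transpose_transpose], by rwa [transpose_transpose], cancel A, cancel B⟩

theorem trans (h : OrthogonallySimilar A B A' B') (h' : OrthogonallySimilar A' B' A'' B'') :
    OrthogonallySimilar A B A'' B'' := by
  obtain ⟨U, hU, hU', rfl, rfl⟩ := h
  obtain ⟨V, hV, hV', rfl, rfl⟩ := h'
  refine ⟨V * U, ?_, ?_, ?_, ?_⟩
  · rw [transpose_mul, Matrix.mul_assoc, ← Matrix.mul_assoc U, hU, Matrix.one_mul, hV]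
  · rw [transpose_mul, Matrix.mul_assoc, ← Matrix.mul_assoc Vᵀ, hV', Matrix.one_mul, hU']
  · simp only [transpose_mul, Matrix.mul_assoc]
  · simp only [transpose_mul, Matrix.mul_assoc]

theorem trace_pow_left (h : OrthogonallySimilar A B A' B') (k : ℕ) :
    (A' ^ k).trace = (A ^ k).trace := by
  obtain ⟨U, hU, hU', rfl, -⟩ := h
  have pow_eq : (U * A * Uᵀ) ^ k = U * A ^ k * Uᵀ := by
    induction k with
    | zero => rw [pow_zero, pow_zero, Matrix.mul_one, hU]
    | succ k ih =>
      calc (U * A * Uᵀ) ^ (k + 1)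
          = U * A ^ k * (Uᵀ * U) * A * Uᵀ := by rw [pow_succ, ih]; simp only [Matrix.mul_assoc]
        _ = U * A ^ (k + 1) * Uᵀ := by rw [hU', Matrix.mul_one, Matrix.mul_assoc U, ← pow_succ]
  rw [pow_eq, trace_mul_comm, ← Matrix.mul_assoc, hU', Matrix.one_mul]

theorem trace_right (h : OrthogonallySimilar A B A' B') : B'.trace = B.trace := by
  obtain ⟨U, -, hU', -, rfl⟩ := h
  rw [trace_mul_comm, ← Matrix.mul_assoc, hU', Matrix.one_mul]

end OrthogonallySimilar

theorem of_mul_mul_of_transpose_apply {m n : Type*} [Fintype n] (w : m → n → ℝ)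
    (A : Matrix n n ℝ) (i j : m) : (of w * A * (of w)ᵀ) i j = w i ⬝ᵥ A *ᵥ w j := by
  rw [Matrix.mul_assoc]
  rfl

theorem eq_trace_smul_one {n : Type*} [Fintype n] [DecidableEq n] (hn : Fintype.card n = 1)
    (P : Matrix n n ℝ) : P = P.trace • 1 := by
  obtain ⟨i, hi⟩ := Fintype.card_eq_one_iff.1 hn
  ext j k
  rw [hi j, hi k, trace, Fintype.sum_eq_single i fun j hj => absurd (hi j) hj, diag_apply,
    Matrix.smul_apply, one_apply_eq, smul_eq_mul, mul_one]

theorem dotProduct_self_pos {n : Type*} [Fintype n] {w : n → ℝ} (hw : w ≠ 0) : 0 < w ⬝ᵥ w :=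
  dotProduct_star_self_pos_iff.2 hw

namespace IsAnticommutingPair

variable {n : Type*} [Fintype n] [DecidableEq n] {A B : Matrix n n ℝ}

theorem left_eq_zero (h : IsAnticommutingPair A B) (hn : Fintype.card n = 1) : A = 0 := by
  rw [eq_trace_smul_one hn A, trace_eq_zero_of_semiconjBy_neg h.sq_right h.semiconjBy, zero_smul]

theorem trace_right_mul_self (h : IsAnticommutingPair A B) (hn : Fintype.card n = 1) :
    B.trace * B.trace = 1 := by
  have h_sq := congrArg trace h.sq_right
  rw [eq_trace_smul_one hn B, smul_mul_smul_comm, Matrix.one_mul, trace_smul, trace_one, hn,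
    Nat.cast_one, smul_eq_mul, mul_one] at h_sq
  exact h_sq

theorem orthogonallySimilar_point (h : IsAnticommutingPair A B) (hn : Fintype.card n = 1) :
    OrthogonallySimilar A B 0 (point B.trace) := by
  let U : Matrix (Fin 1) n ℝ := of fun _ _ => 1
  have hU : U * Uᵀ = 1 := by
    ext i j
    simp [U, mul_apply, hn, one_apply, Subsingleton.elim i j]
  refine ⟨U, hU, (mul_eq_one_comm_of_card_eq _ _ _ (by simp [hn])).1 hU, ?_, ?_⟩
  · rw [h.left_eq_zero hn, Matrix.mul_zero, Matrix.zero_mul]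
  · conv_rhs => rw [eq_trace_smul_one hn B]
    rw [Matrix.mul_smul, Matrix.smul_mul, Matrix.mul_one, hU, point]

theorem mulVec_mulVec_swap (h : IsAnticommutingPair A B) (w : n → ℝ) :
    B *ᵥ A *ᵥ w = -(A *ᵥ B *ᵥ w) := by
  rw [mulVec_mulVec, mulVec_mulVec, eq_neg_of_add_eq_zero_right h.anticomm, neg_mulVec]

theorem dotProduct_mulVec_eq_zero (h : IsAnticommutingPair A B) {s : ℝ} (hs : s ≠ 0) {w : n → ℝ}
    (hw : B *ᵥ w = s • w) : w ⬝ᵥ A *ᵥ w = 0 := by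
  refine (mul_eq_zero.1 (self_eq_neg.1 ?_)).resolve_left hs
  calc s * (w ⬝ᵥ A *ᵥ w)
      = w ⬝ᵥ A *ᵥ B *ᵥ w := by rw [hw, mulVec_smul, dotProduct_smul, smul_eq_mul]
    _ = -(w ⬝ᵥ B *ᵥ A *ᵥ w) := by rw [h.mulVec_mulVec_swap, dotProduct_neg, neg_neg]
    _ = -(B *ᵥ w ⬝ᵥ A *ᵥ w) := by rw [dotProduct_mulVec w, ← mulVec_transpose, h.symm_right.eq]
    _ = -(s * (w ⬝ᵥ A *ᵥ w)) := by rw [hw, smul_dotProduct, smul_eq_mul]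

theorem exists_unit_fixed (h : IsAnticommutingPair A B) (hA : A ≠ 0) :
    ∃ u : n → ℝ, u ⬝ᵥ u = 1 ∧ B *ᵥ u = u ∧ A *ᵥ u ≠ 0 := by
  obtain ⟨w, hBw, hAw⟩ : ∃ w : n → ℝ, B *ᵥ w = w ∧ A *ᵥ w ≠ 0 := by
    by_contra! hfixed
    have left_eq : A = -(A * B) := by
      refine eq_neg_of_add_eq_zero_left (ext_iff_mulVec.2 fun w => ?_)
      have fixed : B *ᵥ (w + B *ᵥ w) = w + B *ᵥ w := by
        rw [mulVec_add, mulVec_mulVec, h.sq_right, one_mulVec, add_comm]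
      simpa only [mulVec_add, mulVec_mulVec, ← add_mulVec, zero_mulVec] using hfixed _ fixed
    have left_eq' : A = -(B * A) := by
      simpa only [transpose_neg, transpose_mul, h.symm_left.eq, h.symm_right.eq] using
        congrArg transpose left_eq
    have self_eq : A = -A := by
      calc A = -(B * A) := left_eq'
        _ = A * B := (eq_neg_of_add_eq_zero_left h.anticomm).symm
        _ = -A := neg_eq_iff_eq_neg.1 left_eq.symm
    exact hA (ext fun i j => self_eq_neg.1 (congrFun₂ self_eq i j))
  have hw : 0 < w ⬝ᵥ w := dotProduct_self_pos fun hw => hAw (by rw [hw, mulVec_zero])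
  refine ⟨(√(w ⬝ᵥ w))⁻¹ • w, ?_, ?_, ?_⟩
  · rw [smul_dotProduct, dotProduct_smul, smul_smul, ← mul_inv, Real.mul_self_sqrt hw.le,
      smul_eq_mul, inv_mul_cancel₀ hw.ne']
  · rw [mulVec_smul, hBw]
  · rw [mulVec_smul]
    exact smul_ne_zero (by positivity) hAw

theorem exists_orthonormal_pair (h : IsAnticommutingPair A B) (hA : A ≠ 0) :
    ∃ (x : ℝ) (u v : n → ℝ), 0 < x ∧ u ⬝ᵥ u = 1 ∧ u ⬝ᵥ v = 0 ∧ v ⬝ᵥ v = 1 ∧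
      B *ᵥ u = u ∧ B *ᵥ v = -v ∧ A *ᵥ u = x • v := by
  obtain ⟨u, hu, hBu, hAu⟩ := h.exists_unit_fixed hA
  have hpos : 0 < A *ᵥ u ⬝ᵥ A *ᵥ u := dotProduct_self_pos hAu
  set x := √(A *ᵥ u ⬝ᵥ A *ᵥ u)
  have hx : 0 < x := Real.sqrt_pos.2 hpos
  have hx_sq : A *ᵥ u ⬝ᵥ A *ᵥ u = x * x := (Real.mul_self_sqrt hpos.le).symm
  refine ⟨x, u, x⁻¹ • A *ᵥ u, hx, hu, ?_, ?_, hBu, ?_, (smul_inv_smul₀ hx.ne' _).symm⟩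
  · rw [dotProduct_smul, h.dotProduct_mulVec_eq_zero one_ne_zero (by rw [hBu, one_smul]),
      smul_zero]
  · rw [smul_dotProduct, dotProduct_smul, hx_sq, smul_eq_mul, smul_eq_mul,
      inv_mul_cancel_left₀ hx.ne', inv_mul_cancel₀ hx.ne']
  · rw [mulVec_smul, h.mulVec_mulVec_swap, hBu, smul_neg]

theorem exists_orthogonallySimilar_flip (h : IsAnticommutingPair A B) (hn : Fintype.card n = 2)
    (hA : A ≠ 0) : ∃ x : ℝ, 0 < x ∧ OrthogonallySimilar A B (flip x) signs := by
  obtain ⟨x, u, v, hx, huu, huv, hvv, hBu, hBv, hAu⟩ := h.exists_orthonormal_pair hA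
  have huAv : u ⬝ᵥ A *ᵥ v = x := by
    rw [dotProduct_mulVec, ← mulVec_transpose, h.symm_left.eq, hAu, smul_dotProduct, hvv,
      smul_eq_mul, mul_one]
  have hvAv : v ⬝ᵥ A *ᵥ v = 0 :=
    h.dotProduct_mulVec_eq_zero (neg_ne_zero.2 one_ne_zero) (by rw [hBv, neg_one_smul])
  let U : Matrix (Fin 2) n ℝ := of ![u, v]
  have hU : U * Uᵀ = 1 := by
    suffices U * (1 : Matrix n n ℝ) * Uᵀ = 1 by rwa [Matrix.mul_one] at this
    ext i j
    rw [of_mul_mul_of_transpose_apply]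
    fin_cases i <;> fin_cases j <;> simp [huu, huv, hvv, dotProduct_comm v u]
  refine ⟨x, hx, U, hU, (mul_eq_one_comm_of_card_eq _ _ _ (by simp [hn])).1 hU, ?_, ?_⟩
  · ext i j
    rw [of_mul_mul_of_transpose_apply]
    fin_cases i <;> fin_cases j <;> simp [flip, hAu, huv, hvv, huAv, hvAv]
  · ext i j
    rw [of_mul_mul_of_transpose_apply]
    fin_cases i <;> fin_cases j <;>
      simp [signs, hBu, hBv, huu, huv, hvv, dotProduct_comm v u]

end IsAnticommutingPair

/-! ### Measures representing an anticommuting sequence -/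

section evalWord

variable {t : ℕ} (A B : Matrix (Fin t) (Fin t) ℝ)

theorem evalWord_append (v w : List Letter) :
    evalWord A B (v ++ w) = evalWord A B v * evalWord A B w := by
  simp only [evalWord, List.map_append, List.prod_append]

theorem evalWord_replicate_X (k : ℕ) : evalWord A B (List.replicate k .X) = A ^ k := by
  simp only [evalWord, List.map_replicate, List.prod_replicate]

theorem evalWord_singleton_Y : evalWord A B [.Y] = B := by
  simp only [evalWord, List.map_singleton, List.prod_singleton]

variable {A B}

theorem evalWord_reverse (hA : A.IsSymm) (hB : B.IsSymm) (w : List Letter) :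
    evalWord A B w.reverse = (evalWord A B w)ᵀ := by
  induction w with
  | nil => exact transpose_one.symm
  | cons l w ih =>
    rw [List.reverse_cons, evalWord_append, ih]
    cases l <;> simp [evalWord, transpose_mul, hA.eq, hB.eq]

theorem trace_evalWord_rotate (w : List Letter) (k : ℕ) :
    (evalWord A B (w.rotate k)).trace = (evalWord A B w).trace := by
  rw [List.rotate_eq_drop_append_take_mod, evalWord_append, trace_mul_comm, ← evalWord_append,
    List.take_append_drop]

end evalWord

namespace AtomicMeasure

/-- The integral `∑ i, λ_i Tr (F_i)`, with the normalized trace `Tr`, of a matrix-valued function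
on the atoms. -/
noncomputable def integral (μ : AtomicMeasure)
    (F : (i : Fin μ.N) → Matrix (Fin (μ.size i)) (Fin (μ.size i)) ℝ) : ℝ :=
  ∑ i, μ.density i * ((1 / (μ.size i : ℝ)) * (F i).trace)

variable {μ : AtomicMeasure} {β : TracialSequence}
  {F G : (i : Fin μ.N) → Matrix (Fin (μ.size i)) (Fin (μ.size i)) ℝ}

theorem integral_congr (h : ∀ i, (F i).trace = (G i).trace) : μ.integral F = μ.integral G := by
  simp only [integral, h]

theorem integral_add : μ.integral (F + G) = μ.integral F + μ.integral G := by
  simp only [integral, Pi.add_apply, trace_add, mul_add, Finset.sum_add_distrib]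

theorem integral_smul (r : ℝ) : μ.integral (r • F) = r * μ.integral F := by
  simp only [integral, Pi.smul_apply, trace_smul, smul_eq_mul, Finset.mul_sum]
  exact Finset.sum_congr rfl fun i _ => by ring

theorem integral_sum {ι : Type*} (s : Finset ι)
    (F : ι → (i : Fin μ.N) → Matrix (Fin (μ.size i)) (Fin (μ.size i)) ℝ) :
    μ.integral (∑ j ∈ s, F j) = ∑ j ∈ s, μ.integral (F j) := by
  classical
  induction s using Finset.induction_on with
  | empty => simp [integral]
  | insert j s hj ih => rw [Finset.sum_insert hj, Finset.sum_insert hj, integral_add, ih]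

theorem integral_one : μ.integral 1 = 1 := by
  have size_ne_zero (i : Fin μ.N) : (μ.size i : ℝ) ≠ 0 := by exact_mod_cast (μ.size_pos i).ne'
  simp only [integral, Pi.one_apply, trace_one, Fintype.card_fin]
  simpa only [one_div_mul_cancel (size_ne_zero _), mul_one] using μ.density_sum

theorem integral_nonneg (h : ∀ i, 0 ≤ (F i).trace) : 0 ≤ μ.integral F :=
  Finset.sum_nonneg fun i _ =>
    mul_nonneg (μ.density_pos i).le (mul_nonneg (by positivity) (h i))

theorem eq_zero_of_integral_transpose_mul_self_eq_zero
    (h : μ.integral (fun i => (F i)ᵀ * F i) = 0) (i : Fin μ.N) : F i = 0 := by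
  have weight_pos : 0 < μ.density i * (1 / (μ.size i : ℝ)) :=
    mul_pos (μ.density_pos i) (one_div_pos.2 (by exact_mod_cast μ.size_pos i))
  rw [integral, Finset.sum_eq_zero_iff_of_nonneg fun j _ => mul_nonneg (μ.density_pos j).le
    (mul_nonneg (by positivity) (trace_transpose_mul_self_nonneg _))] at h
  have trace_eq := h i (Finset.mem_univ i)
  rw [← mul_assoc] at trace_eq
  rw [← conjTranspose_eq_transpose_of_trivial] at trace_eq
  exact trace_conjTranspose_mul_self_eq_zero_iff.1
    ((mul_eq_zero.1 trace_eq).resolve_left weight_pos.ne')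

/-- The sequence of the moments of a measure. -/
noncomputable def moments (μ : AtomicMeasure) : TracialSequence where
  toFun w := μ.integral fun i => evalWord (μ.A i) (μ.B i) w.1
  cyclic := by
    rintro v ⟨_, _⟩ ⟨k, rfl⟩
    exact integral_congr fun i => (trace_evalWord_rotate _ k).symm
  reversal := by
    rintro v ⟨_, _⟩ rfl
    exact integral_congr fun i => by
      rw [evalWord_reverse (μ.A_symm i) (μ.B_symm i), trace_transpose]

theorem represents_moments : μ.Represents μ.moments := fun _ _ => rfl

theorem moments_isAnticommuting (h : ∀ i, IsAnticommutingPair (μ.A i) (μ.B i)) :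
    μ.moments.IsAnticommuting where
  isNormalized := integral_one
  column_XY_add_column_YX := by
    funext j
    refine integral_add.symm.trans (Finset.sum_eq_zero fun i _ => ?_)
    have cancel : evalWord (μ.A i) (μ.B i) [.X, .Y] + evalWord (μ.A i) (μ.B i) [.Y, .X] = 0 := by
      simpa [evalWord] using (h i).anticomm
    rw [Pi.add_apply, evalWord_append, evalWord_append, ← mul_add, cancel, mul_zero, trace_zero,
      mul_zero, mul_zero]
  column_YY := by
    funext j
    refine integral_congr fun i => ?_
    have cancel : evalWord (μ.A i) (μ.B i) [.Y, .Y] = evalWord (μ.A i) (μ.B i) [] := by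
      simpa [evalWord] using (h i).sq_right
    rw [evalWord_append, cancel, ← evalWord_append]

namespace Represents

theorem moment_eq_integral (h : μ.Represents β) (w : List Letter) (hw : w.length ≤ 4) :
    β.moment w hw = μ.integral fun i => evalWord (μ.A i) (μ.B i) w :=
  h w hw

theorem moment_Y (h : μ.Represents β) : β.moment [.Y] = μ.integral μ.B := by
  simp only [h.moment_eq_integral, evalWord_singleton_Y]

theorem moment_XX (h : μ.Represents β) : β.moment [.X, .X] = μ.integral (μ.A ^ 2) := by
  rw [h.moment_eq_integral]
  exact integral_congr fun i => congrArg trace (evalWord_replicate_X _ _ 2)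

theorem moment_XXX (h : μ.Represents β) : β.moment [.X, .X, .X] = μ.integral (μ.A ^ 3) := by
  rw [h.moment_eq_integral]
  exact integral_congr fun i => congrArg trace (evalWord_replicate_X _ _ 3)

theorem moment_XXXX (h : μ.Represents β) : β.moment [.X, .X, .X, .X] = μ.integral (μ.A ^ 4) := by
  rw [h.moment_eq_integral]
  exact integral_congr fun i => congrArg trace (evalWord_replicate_X _ _ 4)

end Represents

end AtomicMeasure

/-- The value at the pair `(A, B)` of the noncommutative polynomial of degree at most `2` with
coefficient vector `v` in the basis `wordsTwo`. -/
def evalQuadratic {t : ℕ} (A B : Matrix (Fin t) (Fin t) ℝ) (v : Fin 7 → ℝ) :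
    Matrix (Fin t) (Fin t) ℝ :=
  ∑ j, v j • evalWord A B (wordsTwo j)

namespace AtomicMeasure

variable {μ : AtomicMeasure} {β : TracialSequence}

namespace Represents

theorem dotProduct_momentMatrix_mulVec (h : μ.Represents β) (v : Fin 7 → ℝ) :
    v ⬝ᵥ β.momentMatrix *ᵥ v = μ.integral fun i =>
      (evalQuadratic (μ.A i) (μ.B i) v)ᵀ * evalQuadratic (μ.A i) (μ.B i) v := by
  have integrand_eq : (fun i => (evalQuadratic (μ.A i) (μ.B i) v)ᵀ *
      evalQuadratic (μ.A i) (μ.B i) v) = ∑ j, ∑ k, (v j * v k) •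
        fun i => evalWord (μ.A i) (μ.B i) ((wordsTwo j).reverse ++ wordsTwo k) := by
    funext i
    simp only [evalQuadratic, transpose_sum, transpose_smul, Finset.sum_mul_sum,
      smul_mul_smul_comm, Finset.sum_apply, Pi.smul_apply, evalWord_append,
      evalWord_reverse (μ.A_symm i) (μ.B_symm i)]
  simp only [integrand_eq, integral_sum, integral_smul, ← h.moment_eq_integral _
    (length_reverse_append_le _ (length_wordsTwo_le _))]
  simp only [dotProduct, mulVec, Finset.mul_sum]
  exact Finset.sum_congr rfl fun j _ => Finset.sum_congr rfl fun k _ => by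
    rw [← mul_assoc, mul_right_comm]
    rfl

theorem posSemidef (h : μ.Represents β) : β.momentMatrix.PosSemidef :=
  .of_dotProduct_mulVec_nonneg β.momentMatrix_isHermitian fun v => by
    rw [star_trivial, h.dotProduct_momentMatrix_mulVec]
    exact integral_nonneg fun i => trace_transpose_mul_self_nonneg _

theorem evalQuadratic_eq_zero (h : μ.Represents β) {v : Fin 7 → ℝ}
    (hv : β.momentMatrix *ᵥ v = 0) (i : Fin μ.N) : evalQuadratic (μ.A i) (μ.B i) v = 0 := by
  refine eq_zero_of_integral_transpose_mul_self_eq_zero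
    (F := fun i => evalQuadratic (μ.A i) (μ.B i) v) ?_ i
  rw [← h.dotProduct_momentMatrix_mulVec, hv, dotProduct_zero]

theorem isAnticommutingPair (h : μ.Represents β) (hβ : β.IsAnticommuting) (i : Fin μ.N) :
    IsAnticommutingPair (μ.A i) (μ.B i) where
  symm_left := μ.A_symm i
  symm_right := μ.B_symm i
  anticomm := by
    have kernel : β.momentMatrix *ᵥ ![0, 0, 0, 0, 1, 1, 0] = 0 := by
      rw [← hβ.column_XY_add_column_YX]
      ext j
      simp [mulVec, dotProduct, Fin.sum_univ_succ, TracialSequence.momentMatrix, wordsTwo]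
    simpa [evalQuadratic, Fin.sum_univ_succ, wordsTwo, evalWord] using
      h.evalQuadratic_eq_zero kernel i
  sq_right := by
    have kernel : β.momentMatrix *ᵥ ![-1, 0, 0, 0, 0, 0, 1] = 0 := by
      rw [← neg_add_eq_zero.2 hβ.column_YY.symm]
      ext j
      simp [mulVec, dotProduct, Fin.sum_univ_succ, TracialSequence.momentMatrix, wordsTwo]
    refine (neg_add_eq_zero.1 ?_).symm
    simpa [evalQuadratic, Fin.sum_univ_succ, wordsTwo, evalWord] using
      h.evalQuadratic_eq_zero kernel i

theorem moment_XXX_eq_zero (h : μ.Represents β) (hβ : β.IsAnticommuting) :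
    β.moment [.X, .X, .X] = 0 := by
  rw [h.moment_XXX]
  exact Finset.sum_eq_zero fun i _ => by
    rw [Pi.pow_apply, (h.isAnticommutingPair hβ i).trace_pow_three, mul_zero, mul_zero]

theorem quadratic_nonneg (h : μ.Represents β) (hβ : β.IsAnticommuting) {s : ℝ} (hs : s * s = 1)
    (p : ℝ) : 0 ≤ β.moment [.X, .X, .X, .X] * (p * p) + 2 * β.moment [.X, .X] * p +
      (1 + s * β.moment [.Y]) := by
  calc 0 ≤ μ.integral (p ^ 2 • μ.A ^ 4 + (2 * p) • μ.A ^ 2 + (1 + s • μ.B)) :=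
        integral_nonneg fun i => by
          simpa only [Pi.add_apply, Pi.smul_apply, Pi.pow_apply, Pi.one_apply, trace_add,
            trace_smul, smul_eq_mul] using (h.isAnticommutingPair hβ i).trace_quadratic_nonneg hs p
    _ = p ^ 2 * β.moment [.X, .X, .X, .X] + 2 * p * β.moment [.X, .X] +
          (1 + s * β.moment [.Y]) := by
        simp only [integral_add, integral_smul, integral_one, h.moment_Y, h.moment_XX,
          h.moment_XXXX]
    _ = _ := by ring

theorem sq_moment_XX_le (h : μ.Represents β) (hβ : β.IsAnticommuting) :
    β.moment [.X, .X] ^ 2 ≤ β.moment [.X, .X, .X, .X] * (1 - |β.moment [.Y]|) := by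
  have h_plus := discrim_le_zero (h.quadratic_nonneg hβ (one_mul 1))
  have h_minus := discrim_le_zero (h.quadratic_nonneg hβ (s := -1) (by norm_num))
  rw [discrim] at h_plus h_minus
  rcases abs_cases (β.moment [.Y]) with ⟨h_abs, -⟩ | ⟨h_abs, -⟩ <;> rw [h_abs] <;> linarith

theorem of_moments (hβ : β.IsAnticommuting)
    (hμ : ∀ i, IsAnticommutingPair (μ.A i) (μ.B i))
    (hY : μ.integral μ.B = β.moment [.Y]) (hXX : μ.integral (μ.A ^ 2) = β.moment [.X, .X])
    (hXXX : μ.integral (μ.A ^ 3) = β.moment [.X, .X, .X])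
    (hXXXX : μ.integral (μ.A ^ 4) = β.moment [.X, .X, .X, .X]) : μ.Represents β := by
  have h_moments := moments_isAnticommuting hμ
  intro w hw
  rw [hβ.moment_eq w hw, ← hY, ← hXX, ← hXXX, ← hXXXX, ← represents_moments.moment_Y,
    ← represents_moments.moment_XX, ← represents_moments.moment_XXX,
    ← represents_moments.moment_XXXX, ← h_moments.moment_eq w hw]
  rfl

end Represents

end AtomicMeasure

/-! ### The canonical measure of an admissible sequence -/

namespace TracialSequence

/-- The density `β_{X²}² / β_{X⁴}` that an atom of size two is forced to have when all other atoms
have size one. -/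
noncomputable def blockDensity (β : TracialSequence) : ℝ :=
  β.moment [.X, .X] ^ 2 / β.moment [.X, .X, .X, .X]

/-- The total density that the atoms `(0, s)` of size one, for a sign `s`, are then left with. -/
noncomputable def pointMass (β : TracialSequence) (s : ℝ) : ℝ :=
  (1 - β.blockDensity + s * β.moment [.Y]) / 2

/-- The signs `s` for which an atom `(0, s)` of size one is needed. -/
noncomputable def signSupport (β : TracialSequence) : Finset ℝ :=
  {s ∈ {1, -1} | β.pointMass s ≠ 0}

/-- The anticommuting sequences that have a representing measure with exactly one atom of size two
and no larger atoms. -/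
structure IsAdmissible (β : TracialSequence) : Prop extends β.IsAnticommuting where
  moment_XX_pos : 0 < β.moment [.X, .X]
  moment_XXXX_pos : 0 < β.moment [.X, .X, .X, .X]
  moment_XXX : β.moment [.X, .X, .X] = 0
  blockDensity_le : β.blockDensity ≤ 1 - |β.moment [.Y]|

variable {β : TracialSequence}

theorem mul_self_of_mem_signSupport {s : ℝ} (hs : s ∈ β.signSupport) : s * s = 1 := by
  rw [signSupport, Finset.mem_filter, Finset.mem_insert, Finset.mem_singleton] at hs
  exact mul_self_eq_one_iff.2 hs.1

theorem sum_signSupport (f : ℝ → ℝ) : ∑ s ∈ β.signSupport, β.pointMass s * f s =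
    β.pointMass 1 * f 1 + β.pointMass (-1) * f (-1) := by
  rw [signSupport, Finset.sum_filter_of_ne fun s _ => left_ne_zero_of_mul,
    Finset.sum_pair (by norm_num)]

namespace IsAdmissible

theorem blockDensity_pos (hβ : β.IsAdmissible) : 0 < β.blockDensity :=
  div_pos (pow_pos hβ.moment_XX_pos 2) hβ.moment_XXXX_pos

theorem pointMass_nonneg (hβ : β.IsAdmissible) {s : ℝ} (hs : s * s = 1) : 0 ≤ β.pointMass s := by
  have h_le := hβ.blockDensity_le
  have h_abs := abs_le.1 (le_refl |β.moment [.Y]|)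
  rw [pointMass]
  rcases mul_self_eq_one_iff.1 hs with rfl | rfl <;> linarith

theorem pointMass_pos (hβ : β.IsAdmissible) {s : ℝ} (hs : s ∈ β.signSupport) :
    0 < β.pointMass s :=
  (hβ.pointMass_nonneg (mul_self_of_mem_signSupport hs)).lt_of_ne' (Finset.mem_filter.1 hs).2

theorem blockDensity_mul_sq (hβ : β.IsAdmissible) :
    β.blockDensity * √(β.moment [.X, .X, .X, .X] / β.moment [.X, .X]) ^ 2 = β.moment [.X, .X] := by
  have hXX := hβ.moment_XX_pos
  have hXXXX := hβ.moment_XXXX_pos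
  rw [blockDensity, Real.sq_sqrt (by positivity)]
  field_simp

theorem blockDensity_mul_pow_four (hβ : β.IsAdmissible) :
    β.blockDensity * √(β.moment [.X, .X, .X, .X] / β.moment [.X, .X]) ^ 4 =
      β.moment [.X, .X, .X, .X] := by
  have hXX := hβ.moment_XX_pos
  have hXXXX := hβ.moment_XXXX_pos
  rw [pow_mul _ 2 2, Real.sq_sqrt (by positivity), blockDensity]
  field_simp

end IsAdmissible

end TracialSequence

/-- The measure with one atom `(flip x, signs)`, for the `x` that the moments force, and one atom
`(0, s)` of size one for each sign `s` in the support. -/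
noncomputable def canonicalMeasure {β : TracialSequence} (hβ : β.IsAdmissible) :
    AtomicMeasure where
  N := β.signSupport.card + 1
  size := Fin.cases 2 fun _ => 1
  size_pos := Fin.cases two_pos fun _ => one_pos
  density := Fin.cases β.blockDensity fun j => β.pointMass (β.signSupport.equivFin.symm j)
  density_pos := Fin.cases hβ.blockDensity_pos fun j =>
    hβ.pointMass_pos (β.signSupport.equivFin.symm j).2
  density_sum := by
    have sum_points : ∑ s ∈ β.signSupport, β.pointMass s = 1 - β.blockDensity := by
      simpa only [mul_one, TracialSequence.pointMass, neg_one_mul, one_mul, ← add_div,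
        add_add_add_comm, add_neg_cancel, add_zero, add_self_div_two]
        using TracialSequence.sum_signSupport (β := β) fun _ => 1
    rw [Fin.sum_univ_succ, Fin.cases_zero]
    simp only [Fin.cases_succ]
    rw [Equiv.sum_comp β.signSupport.equivFin.symm fun s => β.pointMass s,
      Finset.sum_coe_sort β.signSupport, sum_points, add_sub_cancel]
  A := Fin.cases (flip √(β.moment [.X, .X, .X, .X] / β.moment [.X, .X])) fun _ =>
    (0 : Matrix (Fin 1) (Fin 1) ℝ)
  B := Fin.cases signs fun j => point (β.signSupport.equivFin.symm j)
  A_symm := Fin.cases (isAnticommutingPair_flip_signs _).symm_left fun _ => isSymm_zero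
  B_symm := Fin.cases (isAnticommutingPair_flip_signs 1).symm_right fun _ => isSymm_one.smul _

namespace canonicalMeasure

variable {β : TracialSequence} (hβ : β.IsAdmissible)

theorem isAnticommutingPair : ∀ i, IsAnticommutingPair ((canonicalMeasure hβ).A i)
    ((canonicalMeasure hβ).B i) :=
  Fin.cases (isAnticommutingPair_flip_signs _) fun j => isAnticommutingPair_zero_point
    (TracialSequence.mul_self_of_mem_signSupport (β.signSupport.equivFin.symm j).2)

theorem integral_eq {F : (i : Fin (β.signSupport.card + 1)) →
    Matrix (Fin ((canonicalMeasure hβ).size i)) (Fin ((canonicalMeasure hβ).size i)) ℝ}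
    {x : ℝ} {f : ℝ → ℝ} (h_block : (F 0).trace = 2 * x)
    (h_point : ∀ j, (F (Fin.succ j)).trace = f (β.signSupport.equivFin.symm j)) :
    (canonicalMeasure hβ).integral F =
      β.blockDensity * x + (β.pointMass 1 * f 1 + β.pointMass (-1) * f (-1)) := by
  refine (Fin.sum_univ_succ _).trans (congrArg₂ (· + ·) ?_ ?_)
  · change β.blockDensity * (1 / ((2 : ℕ) : ℝ) * (F 0).trace) = _
    rw [h_block, Nat.cast_ofNat, one_div, inv_mul_cancel_left₀ two_ne_zero]
  · rw [← TracialSequence.sum_signSupport, ← Finset.sum_coe_sort β.signSupport,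
      ← Equiv.sum_comp β.signSupport.equivFin.symm]
    refine Finset.sum_congr rfl fun j _ => ?_
    change β.pointMass (β.signSupport.equivFin.symm j) *
      (1 / ((1 : ℕ) : ℝ) * (F (Fin.succ j)).trace) = _
    rw [h_point, Nat.cast_one, one_div_one, one_mul]

theorem integral_pow {k : ℕ} (hk : k ≠ 0) {x : ℝ}
    (hx : (flip √(β.moment [.X, .X, .X, .X] / β.moment [.X, .X]) ^ k).trace = 2 * x) :
    (canonicalMeasure hβ).integral ((canonicalMeasure hβ).A ^ k) = β.blockDensity * x := by
  have trace_zero_pow : ((0 : Matrix (Fin 1) (Fin 1) ℝ) ^ k).trace = 0 := by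
    rw [zero_pow hk, trace_zero]
  refine (integral_eq hβ (f := 0) hx fun _ => trace_zero_pow).trans ?_
  rw [Pi.zero_apply, Pi.zero_apply, mul_zero, mul_zero, add_zero, add_zero]

theorem represents : (canonicalMeasure hβ).Represents β := by
  refine .of_moments hβ.toIsAnticommuting (isAnticommutingPair hβ) ?_ ?_ ?_ ?_
  · refine (integral_eq hβ (x := 0) (f := id) (trace_signs.trans (mul_zero 2).symm) fun j =>
      trace_point _).trans ?_
    simp only [id, TracialSequence.pointMass]
    ring
  · exact (integral_pow hβ two_ne_zero (trace_flip_pow_two _)).trans hβ.blockDensity_mul_sq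
  · refine (integral_pow hβ (x := 0) three_ne_zero ?_).trans ?_
    · rw [(isAnticommutingPair_flip_signs _).trace_pow_three, mul_zero]
    · rw [mul_zero, hβ.moment_XXX]
  · exact (integral_pow hβ four_ne_zero (trace_flip_pow_four _)).trans hβ.blockDensity_mul_pow_four

end canonicalMeasure

/-! ### Measures with a sole atom of size two -/

namespace AtomicMeasure

/-- The atom `i₀` has size two and all other atoms have size one. -/
def IsSoleBlock (μ : AtomicMeasure) (i₀ : Fin μ.N) : Prop :=
  μ.size i₀ = 2 ∧ ∀ i, i ≠ i₀ → μ.size i = 1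

variable {μ ν : AtomicMeasure} {i₀ : Fin μ.N} {k n : ℕ}

theorem hasType_pair_iff : μ.HasType [n, k] ↔ μ.maxSize = 2 ∧ μ.count 1 = n ∧ μ.count 2 = k := by
  constructor
  · rintro ⟨h_length, h_count⟩
    exact ⟨h_length.symm, h_count 0 (by simp), h_count 1 (by simp)⟩
  · rintro ⟨h_max, h_one, h_two⟩
    refine ⟨h_max.symm, fun j hj => ?_⟩
    match j, hj with
    | 0, _ => exact h_one
    | 1, _ => exact h_two

theorem count_maxSize_pos (hμ : μ.maxSize ≠ 0) : 0 < μ.count μ.maxSize := by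
  have univ_nonempty : (Finset.univ : Finset (Fin μ.N)).Nonempty := by
    rw [Finset.nonempty_iff_ne_empty]
    intro h_empty
    exact hμ (by rw [maxSize, h_empty, Finset.sup_empty, Nat.bot_eq_zero])
  obtain ⟨i, hi, h_eq⟩ := Finset.exists_mem_eq_sup _ univ_nonempty μ.size
  exact Finset.card_pos.2 ⟨i, Finset.mem_filter.2 ⟨hi, h_eq.symm⟩⟩

theorem IsSoleBlock.hasType (h : μ.IsSoleBlock i₀) (hN : μ.N = n + 1) : μ.HasType [n, 1] := by
  have size_eq_one_iff (i : Fin μ.N) : μ.size i = 1 ↔ i ≠ i₀ :=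
    ⟨by rintro hi rfl; simp [h.1] at hi, h.2 i⟩
  have size_eq_two_iff (i : Fin μ.N) : μ.size i = 2 ↔ i = i₀ :=
    ⟨fun hi => by_contra fun hne => by simp [h.2 i hne] at hi, by rintro rfl; exact h.1⟩
  refine hasType_pair_iff.2 ⟨le_antisymm (Finset.sup_le fun i _ => ?_) ?_, ?_, ?_⟩
  · rcases eq_or_ne i i₀ with rfl | hi
    · exact h.1.le
    · exact (h.2 i hi).trans_le one_le_two
  · exact h.1.ge.trans (Finset.le_sup (Finset.mem_univ i₀))
  · simp only [count, size_eq_one_iff, Finset.filter_ne', Finset.card_erase_of_mem,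
      Finset.mem_univ, Finset.card_univ, Fintype.card_fin, hN, Nat.add_sub_cancel]
  · simp only [count, size_eq_two_iff, Finset.filter_eq', Finset.mem_univ, if_true,
      Finset.card_singleton]

theorem HasType.exists_isSoleBlock (h : μ.HasType [n, 1]) :
    ∃ i₀, μ.IsSoleBlock i₀ ∧ μ.N = n + 1 := by
  obtain ⟨h_max, h_one, h_two⟩ := hasType_pair_iff.1 h
  obtain ⟨i₀, h_filter⟩ := Finset.card_eq_one.1 h_two
  have size_eq_two_iff (i : Fin μ.N) : μ.size i = 2 ↔ i = i₀ := by
    simpa using Finset.ext_iff.1 h_filter i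
  have h_sole : μ.IsSoleBlock i₀ := by
    refine ⟨(size_eq_two_iff i₀).2 rfl, fun i hi => ?_⟩
    have h_le : μ.size i ≤ 2 := h_max ▸ Finset.le_sup (Finset.mem_univ i)
    have h_ne := mt (size_eq_two_iff i).1 hi
    have h_pos := μ.size_pos i
    omega
  refine ⟨i₀, h_sole, ?_⟩
  obtain ⟨m, hm⟩ := Nat.exists_eq_succ_of_ne_zero (Fin.pos i₀).ne'
  rw [hm, ← h_one, (hasType_pair_iff.1 (h_sole.hasType hm)).2.1]

theorem SmallerType.asymm (h : μ.SmallerType ν) : ¬ν.SmallerType μ := by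
  rcases h with h_lt | ⟨h_eq, j, -, hj_le, hj_lt, hj_eq⟩
  · rintro (h_lt' | ⟨h_eq', -⟩) <;> omega
  · rintro (h_lt' | ⟨-, l, hl_pos, hl_le, hl_lt, hl_eq⟩)
    · omega
    · rcases lt_trichotomy j l with h | rfl | h
      · exact hl_lt.ne (hj_eq l h (h_eq ▸ hl_le)).symm
      · omega
      · exact hj_lt.ne (hl_eq j h (h_eq ▸ hj_le)).symm

theorem HasType.not_smallerType (hμ : μ.HasType [n, k]) (hν : ν.HasType [n, k]) :
    ¬μ.SmallerType ν := by
  rw [hasType_pair_iff] at hμ hν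
  rintro (h_lt | ⟨-, j, hj_pos, hj_le, hj_lt, -⟩)
  · omega
  · have : j = 1 ∨ j = 2 := by omega
    rcases this with rfl | rfl <;> omega

theorem HasType.hasType_or_smallerType (hμ : μ.HasType [n, 1]) (h_max : 2 ≤ ν.maxSize)
    (h_le : ∀ k, ν.HasType [k, 1] → n ≤ k) : ν.HasType [n, 1] ∨ μ.SmallerType ν := by
  obtain ⟨hμ_max, hμ_one, hμ_two⟩ := hasType_pair_iff.1 hμ
  rcases h_max.lt_or_eq with h_max | h_max
  · exact .inr (.inl (hμ_max.trans_lt h_max))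
  have hν_two : 1 ≤ ν.count 2 := h_max ▸ count_maxSize_pos (by omega)
  rcases hν_two.lt_or_eq with hν_two | hν_two
  · exact .inr (.inr ⟨by omega, 2, one_le_two, hμ_max.ge, by omega, fun j _ _ => by omega⟩)
  have hν : ν.HasType [ν.count 1, 1] := hasType_pair_iff.2 ⟨h_max.symm, rfl, hν_two.symm⟩
  rcases (h_le _ hν).lt_or_eq with hν_one | hν_one
  · refine .inr (.inr ⟨by omega, 1, le_rfl, by omega, by omega, fun j hj_lt hj_le => ?_⟩)
    obtain rfl : j = 2 := by omega
    omega
  · exact .inl (hν_one ▸ hν)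

end AtomicMeasure

theorem canonicalMeasure.isSoleBlock {β : TracialSequence} (hβ : β.IsAdmissible) :
    (canonicalMeasure hβ).IsSoleBlock (0 : Fin (β.signSupport.card + 1)) :=
  ⟨rfl, Fin.cases (fun h => (h rfl).elim) fun _ _ => rfl⟩

theorem canonicalMeasure.hasType {β : TracialSequence} (hβ : β.IsAdmissible) :
    (canonicalMeasure hβ).HasType [β.signSupport.card, 1] :=
  (isSoleBlock hβ).hasType rfl

/-! ### Representing measures with a sole atom of size two -/

namespace AtomicMeasure

variable {μ : AtomicMeasure} {β : TracialSequence} {i₀ : Fin μ.N} {s : ℝ}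

theorem Represents.two_le_maxSize (h : μ.Represents β) (hβ : β.IsAnticommuting)
    (hXX : β.moment [.X, .X] ≠ 0) : 2 ≤ μ.maxSize := by
  contrapose! hXX
  have size_le_one (i : Fin μ.N) : μ.size i ≤ 1 :=
    (Finset.le_sup (Finset.mem_univ i)).trans (Nat.lt_succ_iff.1 hXX)
  have left_eq_zero (i : Fin μ.N) : μ.A i = 0 :=
    (h.isAnticommutingPair hβ i).left_eq_zero <| by
      rw [Fintype.card_fin, (size_le_one i).antisymm (μ.size_pos i)]
  rw [h.moment_XX]
  exact Finset.sum_eq_zero fun i _ => by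
    rw [Pi.pow_apply, left_eq_zero, zero_pow two_ne_zero, trace_zero, mul_zero, mul_zero]

namespace IsSoleBlock

theorem card_eq_one (hi₀ : μ.IsSoleBlock i₀) {i : Fin μ.N} (hi : i ≠ i₀) :
    Fintype.card (Fin (μ.size i)) = 1 :=
  (Fintype.card_fin _).trans (hi₀.2 i hi)

theorem integral_pow (hi₀ : μ.IsSoleBlock i₀) (hμ : ∀ i, IsAnticommutingPair (μ.A i) (μ.B i))
    {k : ℕ} (hk : k ≠ 0) {x : ℝ} (hx : (μ.A i₀ ^ k).trace = 2 * x) :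
    μ.integral (μ.A ^ k) = μ.density i₀ * x := by
  rw [integral, Fintype.sum_eq_single i₀ fun i hi => by
    rw [Pi.pow_apply, (hμ i).left_eq_zero (hi₀.card_eq_one hi), zero_pow hk, trace_zero, mul_zero,
      mul_zero], Pi.pow_apply, hx, hi₀.1, Nat.cast_ofNat, one_div, inv_mul_cancel_left₀ two_ne_zero]

theorem density_eq_and_orthogonallySimilar (hi₀ : μ.IsSoleBlock i₀) (hβ : β.IsAdmissible)
    (h : μ.Represents β) : μ.density i₀ = β.blockDensity ∧ OrthogonallySimilar (μ.A i₀) (μ.B i₀)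
      (flip √(β.moment [.X, .X, .X, .X] / β.moment [.X, .X])) signs := by
  have hμ := h.isAnticommutingPair hβ.toIsAnticommuting
  have A_ne_zero : μ.A i₀ ≠ 0 := fun hA => hβ.moment_XX_pos.ne' <| by
    rw [h.moment_XX, hi₀.integral_pow hμ two_ne_zero (x := 0), mul_zero]
    rw [hA, zero_pow two_ne_zero, trace_zero, mul_zero]
  obtain ⟨x, hx, h_sim⟩ := (hμ i₀).exists_orthogonallySimilar_flip
    ((Fintype.card_fin _).trans hi₀.1) A_ne_zero
  have hXX : β.moment [.X, .X] = μ.density i₀ * x ^ 2 := by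
    rw [h.moment_XX, hi₀.integral_pow hμ two_ne_zero]
    rw [← h_sim.trace_pow_left, trace_flip_pow_two]
  have hXXXX : β.moment [.X, .X, .X, .X] = μ.density i₀ * x ^ 4 := by
    rw [h.moment_XXXX, hi₀.integral_pow hμ four_ne_zero]
    rw [← h_sim.trace_pow_left, trace_flip_pow_four]
  have density_ne_zero := (μ.density_pos i₀).ne'
  constructor
  · rw [TracialSequence.blockDensity, hXX, hXXXX]
    field_simp
  · have ratio_eq : μ.density i₀ * x ^ 4 / (μ.density i₀ * x ^ 2) = x ^ 2 := by field_simp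
    rwa [hXX, hXXXX, ratio_eq, Real.sqrt_sq hx.le]

theorem trace_block (hi₀ : μ.IsSoleBlock i₀) (hβ : β.IsAdmissible) (h : μ.Represents β) :
    (μ.B i₀).trace = 0 :=
  (hi₀.density_eq_and_orthogonallySimilar hβ h).2.trace_right.symm.trans trace_signs

theorem pointMass_eq_sum (hi₀ : μ.IsSoleBlock i₀) (hβ : β.IsAdmissible) (h : μ.Represents β)
    (hs : s * s = 1) : β.pointMass s = ∑ i with (μ.B i).trace = s, μ.density i := by
  have summand_eq (i : Fin μ.N) : (μ.density i - (if i = i₀ then μ.density i₀ else 0) +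
      s * (μ.density i * (1 / (μ.size i : ℝ) * (μ.B i).trace))) / 2 =
        if (μ.B i).trace = s then μ.density i else 0 := by
    rcases eq_or_ne i i₀ with rfl | hi
    · have hs_ne : 0 ≠ s := (left_ne_zero_of_mul_eq_one hs).symm
      simp only [hi₀.trace_block hβ h, if_true, if_neg hs_ne]
      ring
    · have sq_eq := (h.isAnticommutingPair hβ.toIsAnticommuting i).trace_right_mul_self
        (hi₀.card_eq_one hi)
      simp only [if_neg hi, hi₀.2 i hi, Nat.cast_one]
      split_ifs with h_label
      · rw [h_label]
        linear_combination μ.density i / 2 * hs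
      · rw [(mul_self_eq_mul_self_iff.1 (sq_eq.trans hs.symm)).resolve_left h_label]
        linear_combination -μ.density i / 2 * hs
  have sum_eq : ∑ i, (if i = i₀ then μ.density i₀ else 0) = β.blockDensity := by
    rw [Finset.sum_ite_eq' Finset.univ, if_pos (Finset.mem_univ i₀),
      (hi₀.density_eq_and_orthogonallySimilar hβ h).1]
  simp only [Finset.sum_filter, ← summand_eq]
  rw [← Finset.sum_div, Finset.sum_add_distrib, Finset.sum_sub_distrib, μ.density_sum, sum_eq,
    ← Finset.mul_sum, TracialSequence.pointMass, h.moment_Y, integral]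

theorem image_trace_eq_signSupport (hi₀ : μ.IsSoleBlock i₀) (hβ : β.IsAdmissible)
    (h : μ.Represents β) :
    (Finset.univ.erase i₀).image (fun i => (μ.B i).trace) = β.signSupport := by
  ext s
  simp only [Finset.mem_image, Finset.mem_erase, Finset.mem_univ, and_true]
  constructor
  · rintro ⟨i, hi, rfl⟩
    have hs := (h.isAnticommutingPair hβ.toIsAnticommuting i).trace_right_mul_self
      (hi₀.card_eq_one hi)
    have mass_pos : 0 < β.pointMass (μ.B i).trace := by
      rw [hi₀.pointMass_eq_sum hβ h hs]
      exact Finset.sum_pos (fun j _ => μ.density_pos j) ⟨i, by simp⟩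
    exact Finset.mem_filter.2 ⟨by simpa using mul_self_eq_one_iff.1 hs, mass_pos.ne'⟩
  · intro hs
    have hs_sq := TracialSequence.mul_self_of_mem_signSupport hs
    have mass_ne_zero := (Finset.mem_filter.1 hs).2
    rw [hi₀.pointMass_eq_sum hβ h hs_sq] at mass_ne_zero
    obtain ⟨i, hi, -⟩ := Finset.exists_ne_zero_of_sum_ne_zero mass_ne_zero
    obtain rfl := (Finset.mem_filter.1 hi).2
    refine ⟨i, ?_, rfl⟩
    rintro rfl
    simp [hi₀.trace_block hβ h] at hs_sq

theorem card_signSupport_lt (hi₀ : μ.IsSoleBlock i₀) (hβ : β.IsAdmissible)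
    (h : μ.Represents β) : β.signSupport.card < μ.N := by
  rw [← hi₀.image_trace_eq_signSupport hβ h]
  exact Finset.card_image_le.trans_lt
    ((Finset.card_erase_lt_of_mem (Finset.mem_univ i₀)).trans_eq (Finset.card_fin _))

theorem injective_trace (hi₀ : μ.IsSoleBlock i₀) (hβ : β.IsAdmissible) (h : μ.Represents β)
    (hN : μ.N = β.signSupport.card + 1) : Function.Injective fun i => (μ.B i).trace := by
  have injOn : Set.InjOn (fun i => (μ.B i).trace) (Finset.univ.erase i₀) := by
    rw [← Finset.card_image_iff, hi₀.image_trace_eq_signSupport hβ h,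
      Finset.card_erase_of_mem (Finset.mem_univ i₀), Finset.card_fin, hN, Nat.add_sub_cancel]
  have trace_ne_block {i : Fin μ.N} (hi : i ≠ i₀) : (μ.B i).trace ≠ (μ.B i₀).trace := by
    rw [hi₀.trace_block hβ h]
    exact left_ne_zero_of_mul_eq_one <|
      (h.isAnticommutingPair hβ.toIsAnticommuting i).trace_right_mul_self (hi₀.card_eq_one hi)
  intro i j h_trace
  by_contra h_ne
  rcases eq_or_ne i i₀ with rfl | hi
  · exact trace_ne_block (Ne.symm h_ne) h_trace.symm
  rcases eq_or_ne j i₀ with rfl | hj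
  · exact trace_ne_block hi h_trace
  · exact h_ne (injOn (by simpa using hi) (by simpa using hj) h_trace)

theorem range_trace (hi₀ : μ.IsSoleBlock i₀) (hβ : β.IsAdmissible) (h : μ.Represents β) :
    Set.range (fun i => (μ.B i).trace) = insert 0 (β.signSupport : Set ℝ) := by
  have univ_eq : (Set.univ : Set (Fin μ.N)) = insert i₀ ↑(Finset.univ.erase i₀) := by
    rw [← Finset.coe_insert, Finset.insert_erase (Finset.mem_univ i₀), Finset.coe_univ]
  rw [← Set.image_univ, univ_eq, Set.image_insert_eq, hi₀.trace_block hβ h, ← Finset.coe_image,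
    hi₀.image_trace_eq_signSupport hβ h]

theorem density_eq_pointMass (hi₀ : μ.IsSoleBlock i₀) (hβ : β.IsAdmissible) (h : μ.Represents β)
    (hN : μ.N = β.signSupport.card + 1) {i : Fin μ.N} (hi : i ≠ i₀) :
    μ.density i = β.pointMass (μ.B i).trace := by
  have hs := (h.isAnticommutingPair hβ.toIsAnticommuting i).trace_right_mul_self
    (hi₀.card_eq_one hi)
  rw [hi₀.pointMass_eq_sum hβ h hs]
  simp only [(hi₀.injective_trace hβ h hN).eq_iff, Finset.filter_eq', Finset.mem_univ, if_true,
    Finset.sum_singleton]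

end IsSoleBlock

theorem HasType.card_signSupport_le (hβ : β.IsAdmissible) (h : μ.Represents β) {k : ℕ}
    (hμ : μ.HasType [k, 1]) : β.signSupport.card ≤ k := by
  obtain ⟨i₀, hi₀, hN⟩ := hμ.exists_isSoleBlock
  exact Nat.lt_succ_iff.1 ((hi₀.card_signSupport_lt hβ h).trans_eq hN)

theorem isMinimal_iff (hβ : β.IsAdmissible) :
    μ.IsMinimal β ↔ μ.Represents β ∧ μ.HasType [β.signSupport.card, 1] := by
  have type_or_smaller {ρ ν : AtomicMeasure} (hρ : ρ.HasType [β.signSupport.card, 1])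
      (h : ν.Represents β) : ν.HasType [β.signSupport.card, 1] ∨ ρ.SmallerType ν :=
    hρ.hasType_or_smallerType (h.two_le_maxSize hβ.toIsAnticommuting hβ.moment_XX_pos.ne')
      fun _ hν => hν.card_signSupport_le hβ h
  constructor
  · rintro ⟨h, h_min⟩
    exact ⟨h, (type_or_smaller (canonicalMeasure.hasType hβ) h).resolve_right
      (h_min _ (canonicalMeasure.represents hβ))⟩
  · rintro ⟨h, hμ⟩
    refine ⟨h, fun ν hν h_smaller => ?_⟩
    rcases type_or_smaller hμ hν with h_type | h_larger
    · exact h_type.not_smallerType hμ h_smaller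
    · exact h_larger.asymm h_smaller

theorem IsMinimal.hasType_iff (hβ : β.IsAdmissible) (hμ : μ.IsMinimal β) {n : ℕ} :
    μ.HasType [n, 1] ↔ β.signSupport.card = n := by
  have h_type := ((isMinimal_iff hβ).1 hμ).2
  refine ⟨fun h => ?_, fun h => h ▸ h_type⟩
  rw [← (hasType_pair_iff.1 h).2.1, (hasType_pair_iff.1 h_type).2.1]

end AtomicMeasure

/-! ### Uniqueness of the minimal measure -/

theorem exists_equiv_of_range_eq {ι κ α : Type*} {f : ι → α} {g : κ → α}
    (hf : Function.Injective f) (hg : Function.Injective g) (h : Set.range f = Set.range g) :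
    ∃ σ : ι ≃ κ, ∀ i, g (σ i) = f i :=
  ⟨((Equiv.ofInjective f hf).trans (Equiv.setCongr h)).trans (Equiv.ofInjective g hg).symm,
    fun i => Equiv.apply_ofInjective_symm hg ⟨f i, h ▸ Set.mem_range_self i⟩⟩

namespace AtomicMeasure

variable {μ ν : AtomicMeasure} {β : TracialSequence} {i₀ : Fin μ.N} {j₀ : Fin ν.N}

namespace IsSoleBlock

theorem trace_eq_zero_iff (hi₀ : μ.IsSoleBlock i₀) (hβ : β.IsAdmissible) (h : μ.Represents β)
    {i : Fin μ.N} : (μ.B i).trace = 0 ↔ i = i₀ := by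
  refine ⟨fun h_trace => ?_, ?_⟩
  · by_contra hi
    have sq_eq := (h.isAnticommutingPair hβ.toIsAnticommuting i).trace_right_mul_self
      (hi₀.card_eq_one hi)
    simp [h_trace] at sq_eq
  · rintro rfl
    exact hi₀.trace_block hβ h

theorem atom_eq_of_trace_eq (hi₀ : μ.IsSoleBlock i₀) (hj₀ : ν.IsSoleBlock j₀)
    (hβ : β.IsAdmissible) (hμ : μ.Represents β) (hν : ν.Represents β)
    (hμN : μ.N = β.signSupport.card + 1) (hνN : ν.N = β.signSupport.card + 1) {i : Fin μ.N}
    {j : Fin ν.N} (h_trace : (ν.B j).trace = (μ.B i).trace) :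
    μ.size i = ν.size j ∧ μ.density i = ν.density j ∧
      OrthogonallySimilar (μ.A i) (μ.B i) (ν.A j) (ν.B j) := by
  have block_iff : j = j₀ ↔ i = i₀ := by
    rw [← hj₀.trace_eq_zero_iff hβ hν, h_trace, hi₀.trace_eq_zero_iff hβ hμ]
  rcases eq_or_ne i i₀ with rfl | hi
  · obtain rfl := block_iff.2 rfl
    obtain ⟨hμ_density, hμ_sim⟩ := hi₀.density_eq_and_orthogonallySimilar hβ hμ
    obtain ⟨hν_density, hν_sim⟩ := hj₀.density_eq_and_orthogonallySimilar hβ hν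
    exact ⟨hi₀.1.trans hj₀.1.symm, hμ_density.trans hν_density.symm, hμ_sim.trans hν_sim.symm⟩
  · have hj : j ≠ j₀ := mt block_iff.1 hi
    refine ⟨(hi₀.2 i hi).trans (hj₀.2 j hj).symm, ?_, ?_⟩
    · rw [hi₀.density_eq_pointMass hβ hμ hμN hi, hj₀.density_eq_pointMass hβ hν hνN hj, h_trace]
    · have hμ_sim := (hμ.isAnticommutingPair hβ.toIsAnticommuting i).orthogonallySimilar_point
        (hi₀.card_eq_one hi)
      have hν_sim := (hν.isAnticommutingPair hβ.toIsAnticommuting j).orthogonallySimilar_point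
        (hj₀.card_eq_one hj)
      rw [← h_trace] at hμ_sim
      exact hμ_sim.trans hν_sim.symm

end IsSoleBlock

theorem IsMinimal.orthogonallyEquivalent (hβ : β.IsAdmissible) (hμ : μ.IsMinimal β)
    (hν : ν.IsMinimal β) : μ.OrthogonallyEquivalent ν := by
  obtain ⟨hμ, hμ_type⟩ := (isMinimal_iff hβ).1 hμ
  obtain ⟨hν, hν_type⟩ := (isMinimal_iff hβ).1 hν
  obtain ⟨i₀, hi₀, hμN⟩ := hμ_type.exists_isSoleBlock
  obtain ⟨j₀, hj₀, hνN⟩ := hν_type.exists_isSoleBlock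
  obtain ⟨σ, hσ⟩ := exists_equiv_of_range_eq (hi₀.injective_trace hβ hμ hμN)
    (hj₀.injective_trace hβ hν hνN)
    ((hi₀.range_trace hβ hμ).trans (hj₀.range_trace hβ hν).symm)
  exact ⟨σ, fun i => hi₀.atom_eq_of_trace_eq hj₀ hβ hμ hν hμN hνN (hσ i)⟩

end AtomicMeasure

namespace TracialSequence.IsAdmissible

variable {β : TracialSequence}

theorem canonicalMeasure_isMinimal (hβ : β.IsAdmissible) : (canonicalMeasure hβ).IsMinimal β :=
  (AtomicMeasure.isMinimal_iff hβ).2 ⟨canonicalMeasure.represents hβ, canonicalMeasure.hasType hβ⟩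

theorem hasUniqueMinimalMeasure (hβ : β.IsAdmissible) : β.HasUniqueMinimalMeasure :=
  ⟨canonicalMeasure hβ, hβ.canonicalMeasure_isMinimal, fun _ hν =>
    hβ.canonicalMeasure_isMinimal.orthogonallyEquivalent hβ hν⟩

theorem admitsNCMeasure (hβ : β.IsAdmissible) : β.AdmitsNCMeasure :=
  ⟨canonicalMeasure hβ, hβ.canonicalMeasure_isMinimal,
    one_lt_two.trans_eq (canonicalMeasure.hasType hβ).1⟩

end TracialSequence.IsAdmissible

/-! ### Admissibility and the minimal type in terms of the moments -/

namespace TracialSequence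

variable {β : TracialSequence}

theorem card_signSupport_eq_one (h : β.blockDensity = 1 - |β.moment [.Y]|)
    (hY : β.moment [.Y] ≠ 0) : β.signSupport.card = 1 := by
  have mass_eq (s : ℝ) : β.pointMass s = (|β.moment [.Y]| + s * β.moment [.Y]) / 2 := by
    rw [pointMass, h, sub_sub_cancel]
  rw [signSupport, Finset.card_eq_one]
  rcases abs_cases (β.moment [.Y]) with ⟨h_abs, -⟩ | ⟨h_abs, -⟩
  · exact ⟨1, by simp [Finset.filter_insert, Finset.filter_singleton, mass_eq, h_abs, hY]⟩
  · exact ⟨-1, by simp [Finset.filter_insert, Finset.filter_singleton, mass_eq, h_abs, hY]⟩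

namespace IsAdmissible

theorem card_signSupport_eq_two (hβ : β.IsAdmissible)
    (h : β.blockDensity ≠ 1 - |β.moment [.Y]|) : β.signSupport.card = 2 := by
  have density_lt := hβ.blockDensity_le.lt_of_ne h
  have h_abs := abs_le.1 (le_refl |β.moment [.Y]|)
  have mass_one : 0 < β.pointMass 1 := by rw [pointMass]; linarith
  have mass_neg_one : 0 < β.pointMass (-1) := by rw [pointMass]; linarith
  rw [signSupport, Finset.filter_true_of_mem, Finset.card_pair (by norm_num)]
  simpa using ⟨mass_one.ne', mass_neg_one.ne'⟩

theorem card_signSupport_eq_one_iff (hβ : β.IsAdmissible) (hY : β.moment [.Y] ≠ 0) :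
    β.signSupport.card = 1 ↔ β.blockDensity = 1 - |β.moment [.Y]| := by
  refine ⟨fun h_card => by_contra fun h_ne => ?_, fun h => card_signSupport_eq_one h hY⟩
  have h_two := hβ.card_signSupport_eq_two h_ne
  omega

theorem blockDensity_eq_iff (hβ : β.IsAdmissible) {r : ℝ} (hr : r ≠ 0) :
    β.blockDensity = r ↔ β.moment [.X, .X, .X, .X] = β.moment [.X, .X] ^ 2 / r := by
  rw [blockDensity, div_eq_iff hβ.moment_XXXX_pos.ne', eq_div_iff hr, eq_comm, mul_comm]

end IsAdmissible

theorem MomentConditions.isAdmissible (h : β.MomentConditions) (hβ : β.IsAnticommuting) :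
    β.IsAdmissible := by
  obtain ⟨hXXX, hXX, -, hY, hXXXX⟩ := h
  have h_pos : 0 < 1 - |β.moment [.Y]| := sub_pos.2 hY
  have hXXXX_pos : 0 < β.moment [.X, .X, .X, .X] := (by positivity : (0 : ℝ) < _).trans_le hXXXX
  exact ⟨hβ, hXX, hXXXX_pos, hXXX, (div_le_comm₀ hXXXX_pos h_pos).2 hXXXX⟩

namespace IsAnticommuting

theorem moment_XX_ne_zero (hβ : β.IsAnticommuting) (hnc : β.IsNoncommutative) :
    β.moment [.X, .X] ≠ 0 := by
  intro hXX
  refine hnc ?_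
  rw [hβ.moment_eq [.X, .X, .Y, .Y], hβ.moment_XYXY, hXX, neg_zero]
  rfl

theorem sq_moment_XX_le (hβ : β.IsAnticommuting) (h : β.momentMatrix.PosSemidef) :
    β.moment [.X, .X] ^ 2 ≤ β.moment [.X, .X, .X, .X] := by
  have moment_nil : β.moment [] = 1 := hβ.isNormalized
  let v : Fin 7 → ℝ := ![-β.moment [.X, .X], 0, 0, 1, 0, 0, 0]
  have form_eq : v ⬝ᵥ β.momentMatrix *ᵥ v =
      β.moment [.X, .X, .X, .X] - β.moment [.X, .X] ^ 2 := by
    simp [v, dotProduct, mulVec, Fin.sum_univ_succ, momentMatrix, column, wordsTwo, moment_nil]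
    ring
  exact sub_nonneg.1 (form_eq ▸ h.dotProduct_mulVec_nonneg v)

/-- In this case `X² = β_{X²} 1` in the column space, which is then spanned by the columns
`1, X, Y, XY`. -/
theorem rank_momentMatrix_le (hβ : β.IsAnticommuting) (hXXX : β.moment [.X, .X, .X] = 0)
    (hY : β.moment [.Y] = 0) (hXXXX : β.moment [.X, .X, .X, .X] = β.moment [.X, .X] ^ 2) :
    β.momentMatrix.rank ≤ 4 := by
  have column_XX (i : Fin 7) : β.column [.X, .X] (by simp) i =
      β.column [] (by simp) i * β.moment [.X, .X] := by
    simp only [column]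
    rw [hβ.moment_eq ((wordsTwo i).reverse ++ [Letter.X, Letter.X]),
      hβ.moment_eq ((wordsTwo i).reverse ++ [])]
    fin_cases i <;> simp [wordsTwo, reducedMoment, hXXXX, hXXX, hY, sq]
  have column_YX (i : Fin 7) :
      β.column [.Y, .X] (by simp) i = -β.column [.X, .Y] (by simp) i :=
    eq_neg_of_add_eq_zero_right (congrFun hβ.column_XY_add_column_YX i)
  let C : Matrix (Fin 7) (Fin 4) ℝ :=
    (of ![β.column [], β.column [.X], β.column [.Y], β.column [.X, .Y]])ᵀ
  let K : Matrix (Fin 4) (Fin 7) ℝ :=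
    !![1, 0, 0, β.moment [.X, .X], 0, 0, 1;
      0, 1, 0, 0, 0, 0, 0;
      0, 0, 1, 0, 0, 0, 0;
      0, 0, 0, 0, 1, -1, 0]
  have factorization : β.momentMatrix = C * K := by
    ext i j
    fin_cases j <;> simp [C, K, mul_apply, Fin.sum_univ_succ, momentMatrix, wordsTwo, column_XX,
      column_YX, hβ.column_YY]
  rw [factorization]
  exact (rank_mul_le_left C K).trans (rank_le_width C)

theorem isAdmissible_of_moment_Y_eq_zero (hβ : β.IsAnticommuting) (hXX : β.moment [.X, .X] ≠ 0)
    (h : β.momentMatrix.PosSemidef) (h_rank : 4 < β.momentMatrix.rank)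
    (hXXX : β.moment [.X, .X, .X] = 0) (hY : β.moment [.Y] = 0) :
    β.IsAdmissible ∧ β.signSupport.card = 2 := by
  have sq_lt : β.moment [.X, .X] ^ 2 < β.moment [.X, .X, .X, .X] :=
    (hβ.sq_moment_XX_le h).lt_of_ne fun h_eq =>
      h_rank.not_ge (hβ.rank_momentMatrix_le hXXX hY h_eq.symm)
  have hXXXX : 0 < β.moment [.X, .X, .X, .X] := (sq_nonneg _).trans_lt sq_lt
  have density_lt : β.blockDensity < 1 - |β.moment [.Y]| := by
    rwa [hY, abs_zero, sub_zero, blockDensity, div_lt_one hXXXX]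
  have h_adm : β.IsAdmissible :=
    ⟨hβ, (moment_XX_nonneg h).lt_of_ne' hXX, hXXXX, hXXX, density_lt.le⟩
  exact ⟨h_adm, h_adm.card_signSupport_eq_two density_lt.ne⟩

end IsAnticommuting

end TracialSequence

theorem AtomicMeasure.Represents.momentConditions {μ : AtomicMeasure} {β : TracialSequence}
    (h : μ.Represents β) (hβ : β.IsAnticommuting) (hXX : β.moment [.X, .X] ≠ 0)
    (hY : β.moment [.Y] ≠ 0) : β.MomentConditions := by
  have sq_le := h.sq_moment_XX_le hβ
  have sq_pos : 0 < β.moment [.X, .X] ^ 2 := by positivity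
  have hXXXX : 0 ≤ β.moment [.X, .X, .X, .X] := h.posSemidef.diag_nonneg (i := 3)
  have h_pos : 0 < 1 - |β.moment [.Y]| := pos_of_mul_pos_right (sq_pos.trans_le sq_le) hXXXX
  exact ⟨h.moment_XXX_eq_zero hβ, (TracialSequence.moment_XX_nonneg h.posSemidef).lt_of_ne' hXX,
    abs_pos.2 hY, sub_pos.1 h_pos, (div_le_iff₀ h_pos).2 sq_le⟩

end TracialMoment

theorem theorem6p7 (β : TracialMoment.TracialSequence)
    (hnorm : β.IsNormalized) (hnc : β.IsNoncommutative)
    (hrank : β.momentMatrix.rank = 5)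
    (hXY : β.column [.X, .Y] + β.column [.Y, .X] = 0)
    (hYY : β.column [.Y, .Y] = β.column []) :
    (β.AdmitsNCMeasure ↔
      (β.momentMatrix.PosSemidef ∧ β.moment [.X, .X, .X] = 0 ∧ β.moment [.Y] = 0) ∨
      (β.momentMatrix.PosSemidef ∧ β.MomentConditions)) ∧
    (β.momentMatrix.PosSemidef → β.moment [.X, .X, .X] = 0 → β.moment [.Y] = 0 →
      β.HasUniqueMinimalMeasure ∧
        ∀ μ : TracialMoment.AtomicMeasure, μ.IsMinimal β → μ.HasType [2, 1]) ∧
    (β.MomentConditions →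
      β.HasUniqueMinimalMeasure ∧
        ∀ μ : TracialMoment.AtomicMeasure, μ.IsMinimal β →
          (μ.HasType [1, 1] ↔
            β.moment [.X, .X, .X, .X] = β.moment [.X, .X] ^ 2 / (1 - |β.moment [.Y]|)) ∧
          (β.moment [.X, .X, .X, .X] ≠ β.moment [.X, .X] ^ 2 / (1 - |β.moment [.Y]|) →
            μ.HasType [2, 1])) := by
  have hβ : β.IsAnticommuting := ⟨hnorm, hXY, hYY⟩
  have hXX := hβ.moment_XX_ne_zero hnc
  have admissible_of_moment_Y := hβ.isAdmissible_of_moment_Y_eq_zero hXX (h_rank := by omega)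
  refine ⟨⟨?_, ?_⟩, fun h hXXX hY => ?_, fun h => ?_⟩
  · rintro ⟨μ, ⟨hμ, -⟩, -⟩
    by_cases hY : β.moment [.Y] = 0
    · exact .inl ⟨hμ.posSemidef, hμ.moment_XXX_eq_zero hβ, hY⟩
    · exact .inr ⟨hμ.posSemidef, hμ.momentConditions hβ hXX hY⟩
  · rintro (⟨h, hXXX, hY⟩ | ⟨-, h⟩)
    · exact (admissible_of_moment_Y h hXXX hY).1.admitsNCMeasure
    · exact (h.isAdmissible hβ).admitsNCMeasure
  · obtain ⟨h_adm, h_card⟩ := admissible_of_moment_Y h hXXX hY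
    exact ⟨h_adm.hasUniqueMinimalMeasure, fun _ hμ => (hμ.hasType_iff h_adm).2 h_card⟩
  · have h_adm := h.isAdmissible hβ
    obtain ⟨-, -, hY_pos, hY_lt, -⟩ := h
    rw [ne_eq, ← h_adm.blockDensity_eq_iff (sub_pos.2 hY_lt).ne']
    refine ⟨h_adm.hasUniqueMinimalMeasure, fun μ hμ => ⟨?_, fun h_ne => ?_⟩⟩
    · rw [hμ.hasType_iff h_adm, h_adm.card_signSupport_eq_one_iff (abs_pos.1 hY_pos)]
    · exact (hμ.hasType_iff h_adm).2 (h_adm.card_signSupport_eq_two h_ne)
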